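/- Let $I$ be a finite set and $\Omega=(\Omega_{ij})_{i,j\in I}$ an integer matrix such that $\Omega_{ii}>0$; $\Omega_{ij}\le 0$ and $(\Omega_{ij}+\Omega_{ji})/\Omega_{ii}\in\mathbb Z_{\le 0}$ for $i\neq j$; and $\gcd_i \Omega_{ii}=1$. Let $\langle\,,\rangle$ be the bilinear form on $\mathbb Z[I]$ with $\langle i,j\rangle=\Omega_{ij}$, and put $\lambda\cdot\mu=\langle\lambda,\mu\rangle+\langle\mu,\lambda\rangle$, $\{\lambda,\mu\}=v^{\lambda\cdot\mu}t^{\langle\mu,\lambda\rangle-\langle\lambda,\mu\rangle}$, $v_i=v^{\Omega_{ii}}$, $t_i=t^{\Omega_{ii}}$, $[n]_{v,t}=\frac{(vt)^n-(vt^{-1})^{-n}}{vt-(vt^{-1})^{-1}}$, $[n]^!_{v,t}=\prod_{k=1}^n[k]_{v,t}$. Let $U=U_{v,t}$ be the $\mathbb Q(v,t)$-algebra with generators $E_i,F_i,K_i^{\pm1},K_i'^{\pm1}$ ($i\in I$) and relations $K_i^{\pm1}K_i^{\mp1}=K_i'^{\pm1}K_i'^{\mp1}=1$; $K_iE_jK_i^{-1}=v^{i\cdot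 j}t^{\langle j,i\rangle-\langle i,j\rangle}E_j$, $K'_iE_jK_i'^{-1}=v^{-i\cdot j}t^{\langle j,i\rangle-\langle i,j\rangle}E_j$, $K'_iF_jK_i'^{-1}=v^{i\cdot j}t^{\langle i,j\rangle-\langle j,i\rangle}F_j$, $K_iF_jK_i^{-1}=v^{-i\cdot j}t^{\langle i,j\rangle-\langle j,i\rangle}F_j$; $E_iF_j-F_jE_i=\delta_{ij}\frac{K_i-K'_i}{v_i-v_i^{-1}}$; and, for $i\ne j$, with $X_i^{(p)}=X_i^p/[p]^!_{v_i,t_i}$, both $\sum_{p+p'}(-1)^p t^{-p(\Omega_{ii}p'-\Omega_{ij}+\Omega_{ji})}E_i^{(p)}E_jE_i^{(p')}=0$ and $\sum_{p+p'}(-1)^p t^{-p(\Omega_{ii}p'-\Omega_{ij}+\Omega_{ji})}F_i^{(p')}F_jF_i^{(p)}=0$, the sums being over $p,p'\ge0$ with $p+p'=1-(\Omega_{ij}+\Omega_{ji})/\Omega_{ii}$. Let $(\,,)_\phi$ be the skew-Hopf pairing between the subalgebras $U_{\ge0}$ (generated by $E_i,K_i^{\pm1}$) and $U_{\le0}$ (generated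 by $F_i,K_i'^{\pm1}$) with $(E_i,F_j)_\phi=\delta_{ij}(v_i^{-1}-v_i)^{-1}$, $(K_\mu,K'_\nu)_\phi=\{\mu,\nu\}$, $(E_i,K'_j)_\phi=(K_i,F_j)_\phi=0$, $(x,yy')_\phi=(\Delta x,y\otimes y')_\phi$, $(xx',y)_\phi=(x\otimes x',\Delta^{op}y)_\phi$, where $\Delta(K_i)=K_i\otimes K_i$, $\Delta(K'_i)=K'_i\otimes K'_i$, $\Delta(E_i)=E_i\otimes1+K_i\otimes E_i$, $\Delta(F_i)=1\otimes F_i+F_i\otimes K'_i$. For $\mu\in\mathbb N[I]$ let $U^+_\mu$ and $U^-_{-\mu}$ be the spans of the monomials of degree $\mu$ in the $E_i$ and in the $F_i$; they are nondegenerately paired by $(\,,)_\phi$. Put $\Theta_\mu=\sum_{b} b\otimes b^*$, where $b$ runs over any basis of $U^-_{-\mu}$ and $(b^*)$ is the dual basis of $U^+_\mu$. A $U$-module $M$ is a weight module if $M=\bigoplus_{\lambda\in\mathbb Z[I]}M_\lambda$, where $M_\lambda$ is the space of $m\in M$ with $K_im=v^{i\cdot\lambda}t^{\langle\lambda,i\rangle-\langle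 i,\lambda\rangle}m$ and $K'_im=v^{-i\cdot\lambda}t^{\langle\lambda,i\rangle-\langle i,\lambda\rangle}m$ for all $i\in I$. For finite-dimensional weight modules $M,M'$ let $P:M\otimes M'\to M'\otimes M$ be the flip, let $\tilde f$ be the linear map on $M'\otimes M$ with $\tilde f(m'\otimes m)=\{\lambda,\mu\}^{-1}\,m'\otimes m$ for $m'\in M'_\lambda$, $m\in M_\mu$, let $\Theta=\sum_{\mu\in\mathbb N[I]}\Theta_\mu$ act on $M'\otimes M$ (only finitely many terms act nontrivially), and let $\mathcal R_{M,M'}=\Theta\circ\tilde f\circ P:M\otimes M'\to M'\otimes M$. On triple tensor products write $\mathcal R_{12}=\mathcal R\otimes\mathrm{Id}$ and $\mathcal R_{23}=\mathrm{Id}\otimes\mathcal R$. Then for all finite-dimensional weight $U$-modules $M_1,M_2,M_3$, $$\mathcal R_{12}\circ\mathcal R_{23}\circ\mathcal R_{12}=\mathcal R_{23}\circ\mathcal R_{12}\circ\mathcal R_{23}:\ M_1\otimes M_2\otimes M_3\to M_3\otimes M_2\otimes M_1 .$$ -/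

import Mathlib

open scoped TensorProduct

universe u

noncomputable section

namespace TwoParam

/-! ### The ground field and the bilinear forms -/

/-- The field `ℚ(v,t)` of rational functions in two indeterminates. -/
def 𝕜 : Type := FractionRing (MvPolynomial (Fin 2) ℚ)

instance instFieldK : Field 𝕜 := inferInstanceAs (Field (FractionRing (MvPolynomial (Fin 2) ℚ)))

/-- The indeterminate `v`. -/
def v : 𝕜 :=
  algebraMap (MvPolynomial (Fin 2) ℚ) (FractionRing (MvPolynomial (Fin 2) ℚ)) (MvPolynomial.X 0)

/-- The indeterminate `t`. -/
def t : 𝕜 :=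
  algebraMap (MvPolynomial (Fin 2) ℚ) (FractionRing (MvPolynomial (Fin 2) ℚ)) (MvPolynomial.X 1)

variable {I : Type u} [Fintype I] [DecidableEq I]

/-- The conditions on the integer matrix `Ω` (over a finite index set) that encodes the Cartan
datum; the symmetric form of the Cartan datum is `i · j = Ω i j + Ω j i`. -/
structure IsCartan (Ω : I → I → ℤ) : Prop where
  diag_pos : ∀ i, 0 < Ω i i
  offdiag_nonpos : ∀ i j, i ≠ j → Ω i j ≤ 0
  dvd : ∀ i j, i ≠ j → Ω i i ∣ Ω i j + Ω j i
  gcd_eq_one : Finset.univ.gcd (fun i => Ω i i) = 1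

variable (Ω : I → I → ℤ)

/-- `⟨lam, mu⟩`, the bilinear form on `ℤ[I]` with `⟨i, j⟩ = Ω i j`. -/
def ang (lam mu : I → ℤ) : ℤ := ∑ i, ∑ j, lam i * Ω i j * mu j

/-- `lam · mu = ⟨lam, mu⟩ + ⟨mu, lam⟩`. -/
def dot (lam mu : I → ℤ) : ℤ := ang Ω lam mu + ang Ω mu lam

/-- The multiplicative form `{lam, mu} = v ^ (lam · mu) * t ^ (⟨mu, lam⟩ - ⟨lam, mu⟩)`. -/
def brace (lam mu : I → ℤ) : 𝕜 :=
  v ^ dot Ω lam mu * t ^ (ang Ω mu lam - ang Ω lam mu)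

/-- The element `i` of `ℤ[I]`. -/
def e (i : I) : I → ℤ := Pi.single i 1

/-- `v_i = v ^ (i·i/2)`, where `i·i/2 = Ω i i`. -/
def vi (i : I) : 𝕜 := v ^ Ω i i

/-- `t_i = t ^ (i·i/2)`. -/
def ti (i : I) : 𝕜 := t ^ Ω i i

/-- The two-parameter quantum integer `[n]_{a,b}`. -/
def qint (a b : 𝕜) (n : ℕ) : 𝕜 :=
  ((a * b) ^ n - ((a * b⁻¹) ^ n)⁻¹) / (a * b - (a * b⁻¹)⁻¹)

/-- The quantum factorial `[n]!_{a,b}`. -/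
def qfact (a b : 𝕜) (n : ℕ) : 𝕜 := ∏ k ∈ Finset.range n, qint a b (k + 1)

/-! ### The algebra `U_{v,t}` -/

/-- Generators of `U_{v,t}`; `Ki`, `Ki'` stand for the inverses of `K`, `K'`. -/
inductive Gen (I : Type u) : Type u
  | E (i : I) | F (i : I) | K (i : I) | Ki (i : I) | K' (i : I) | Ki' (i : I)

/-- The free algebra on the generators of `U_{v,t}`. -/
abbrev FreeGen (I : Type u) : Type u := FreeAlgebra 𝕜 (Gen I)

/-- A generator as an element of the free algebra. -/
abbrev g (x : Gen I) : FreeGen I := FreeAlgebra.ι 𝕜 x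

/-- `1 - 2 (i·j)/(i·i)`. -/
def serreN (i j : I) : ℕ := (1 - (Ω i j + Ω j i) / Ω i i).toNat

/-- The coefficient `(-1)^p t_i ^ (-p (p' - 2⟨i,j⟩/(i·i) + 2⟨j,i⟩/(i·i)))`, divided by
`[p]!_{v_i,t_i} [p']!_{v_i,t_i}`; the exponent of `t` is cleared of denominators by
`i·i/2 = Ω i i`. -/
def serreCoeff (i j : I) (p p' : ℕ) : 𝕜 :=
  (-1) ^ p * t ^ (-(p : ℤ) * (Ω i i * p' - Ω i j + Ω j i)) /
    (qfact (vi Ω i) (ti Ω i) p * qfact (vi Ω i) (ti Ω i) p')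

open Gen in
/-- The defining relations (R1)-(R4) of `U_{v,t}`. -/
inductive Rel : FreeGen I → FreeGen I → Prop
  | K_Ki (i : I) : Rel (g (K i) * g (Ki i)) 1
  | Ki_K (i : I) : Rel (g (Ki i) * g (K i)) 1
  | K'_Ki' (i : I) : Rel (g (K' i) * g (Ki' i)) 1
  | Ki'_K' (i : I) : Rel (g (Ki' i) * g (K' i)) 1
  | K_E (i j : I) : Rel (g (K i) * g (E j) * g (Ki i))
      ((v ^ (Ω i j + Ω j i) * t ^ (Ω j i - Ω i j)) • g (E j))
  | K'_E (i j : I) : Rel (g (K' i) * g (E j) * g (Ki' i))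
      ((v ^ (-(Ω i j + Ω j i)) * t ^ (Ω j i - Ω i j)) • g (E j))
  | K'_F (i j : I) : Rel (g (K' i) * g (F j) * g (Ki' i))
      ((v ^ (Ω i j + Ω j i) * t ^ (Ω i j - Ω j i)) • g (F j))
  | K_F (i j : I) : Rel (g (K i) * g (F j) * g (Ki i))
      ((v ^ (-(Ω i j + Ω j i)) * t ^ (Ω i j - Ω j i)) • g (F j))
  | E_F_same (i : I) : Rel (g (E i) * g (F i) - g (F i) * g (E i))
      ((vi Ω i - (vi Ω i)⁻¹)⁻¹ • (g (K i) - g (K' i)))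
  | E_F_ne (i j : I) (h : i ≠ j) : Rel (g (E i) * g (F j) - g (F j) * g (E i)) 0
  | serre_E (i j : I) (h : i ≠ j) :
      Rel (∑ p ∈ Finset.HasAntidiagonal.antidiagonal (serreN Ω i j),
        serreCoeff Ω i j p.1 p.2 • (g (E i) ^ p.1 * g (E j) * g (E i) ^ p.2)) 0
  | serre_F (i j : I) (h : i ≠ j) :
      Rel (∑ p ∈ Finset.HasAntidiagonal.antidiagonal (serreN Ω i j),
        serreCoeff Ω i j p.1 p.2 • (g (F i) ^ p.2 * g (F j) * g (F i) ^ p.1)) 0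

/-- The two-parameter quantum algebra `U_{v,t}` of the Cartan datum `Ω`. -/
def U : Type u := RingQuot (Rel Ω)

instance instRingU : Ring (U Ω) := inferInstanceAs (Ring (RingQuot (Rel Ω)))

instance instAlgebraU : Algebra 𝕜 (U Ω) := inferInstanceAs (Algebra 𝕜 (RingQuot (Rel Ω)))

/-- The quotient map from the free algebra. -/
def mkU : FreeGen I →ₐ[𝕜] U Ω := RingQuot.mkAlgHom 𝕜 (Rel Ω)

set_option linter.unusedSectionVars false in
theorem mkU_rel {a b : FreeGen I} (h : Rel Ω a b) : mkU Ω a = mkU Ω b :=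
  RingQuot.mkAlgHom_rel 𝕜 h

/-- The image of a generator in `U_{v,t}`. -/
def gen (x : Gen I) : U Ω := mkU Ω (g x)

/-! ### The free algebra `'f` and its images in `U_{v,t}` -/

/-- The free algebra `'f` on symbols `θ_i`. -/
abbrev FF (I : Type u) : Type u := FreeAlgebra 𝕜 I

/-- The algebra map `'f → U⁺`, `θ_i ↦ E_i`. -/
def plus : FF I →ₐ[𝕜] U Ω := FreeAlgebra.lift 𝕜 (fun i => gen Ω (Gen.E i))

/-- The (`ℚ(v,t)`-linear) algebra map `'f → U⁻`, `θ_i ↦ F_i`. -/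
def minus : FF I →ₐ[𝕜] U Ω := FreeAlgebra.lift 𝕜 (fun i => gen Ω (Gen.F i))

/-- The monomial `θ_{i₁} ⋯ θ_{iₗ}`. -/
def word (w : List I) : FF I := (w.map (FreeAlgebra.ι 𝕜)).prod

/-- The subspace `'f_mu` of homogeneous elements of degree `mu ∈ ℕ[I]`. -/
def homog (mu : I → ℕ) : Submodule 𝕜 (FF I) :=
  Submodule.span 𝕜 {x | ∃ w : List I, (∀ i, w.count i = mu i) ∧ x = word w}

/-! ### The skew-Hopf pairing

The skew-Hopf pairing `(,)_φ` between `U_{≥0}` and `U_{≤0}` is constructed on free covers of these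
algebras.  It is characterised by the values on generators together with
`(x, y y') = (Δ x, y ⊗ y')` and `(x x', y) = (x ⊗ x', Δᵒᵖ y)`.  On the generators of the second
factor, the latter rule says that `(·, K'_j)` is multiplicative and that
`(x x', F_j) = (x, F_j) ε(x') + (x, K'_j) (x', F_j)`. -/

/-- Generators of a free cover of `U_{≥0}` (`x = E`, `k = K`, `ki = K⁻¹`) or of `U_{≤0}`
(`x = F`, `k = K'`, `ki = K'⁻¹`). -/
inductive BGen (I : Type u) : Type u
  | x (i : I) | k (i : I) | ki (i : I)

/-- The free algebra on Borel generators. -/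
abbrev Borel (I : Type u) : Type u := FreeAlgebra 𝕜 (BGen I)

/-- The coproduct on the cover of `U_{≥0}`: `Δ E_i = E_i ⊗ 1 + K_i ⊗ E_i`,
`Δ K_i^{±1} = K_i^{±1} ⊗ K_i^{±1}`. -/
def comulPos : Borel I →ₐ[𝕜] Borel I ⊗[𝕜] Borel I :=
  FreeAlgebra.lift 𝕜 fun
    | .x i => FreeAlgebra.ι 𝕜 (.x i) ⊗ₜ 1 + FreeAlgebra.ι 𝕜 (.k i) ⊗ₜ FreeAlgebra.ι 𝕜 (.x i)
    | .k i => FreeAlgebra.ι 𝕜 (.k i) ⊗ₜ FreeAlgebra.ι 𝕜 (.k i)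
    | .ki i => FreeAlgebra.ι 𝕜 (.ki i) ⊗ₜ FreeAlgebra.ι 𝕜 (.ki i)

/-- The counit on the cover of `U_{≥0}`. -/
def counitPos : Borel I →ₐ[𝕜] 𝕜 :=
  FreeAlgebra.lift 𝕜 fun
    | .x _ => 0
    | .k _ => 1
    | .ki _ => 1

/-- `x ↦ !![(x, K'_j), (x, F_j); 0, ε(x)]`, an algebra homomorphism by the rules for
`(x x', K'_j)` and `(x x', F_j)`; here `(E_i, F_j) = δ_ij (v_i⁻¹ - v_i)⁻¹`,
`(K_i, K'_j) = {i, j}`, `(E_i, K'_j) = 0` and `(K_i, F_j) = 0`. -/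
def pairGen (j : I) : Borel I →ₐ[𝕜] Matrix (Fin 2) (Fin 2) 𝕜 :=
  FreeAlgebra.lift 𝕜 fun
    | .x i => !![0, if i = j then ((vi Ω i)⁻¹ - vi Ω i)⁻¹ else 0; 0, 0]
    | .k i => !![brace Ω (e i) (e j), 0; 0, 1]
    | .ki i => !![(brace Ω (e i) (e j))⁻¹, 0; 0, 1]

/-- `x ↦ (x, K'_j⁻¹)`. -/
def pairKinv (j : I) : Borel I →ₐ[𝕜] 𝕜 :=
  FreeAlgebra.lift 𝕜 fun
    | .x _ => 0
    | .k i => (brace Ω (e i) (e j))⁻¹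
    | .ki i => brace Ω (e i) (e j)

/-- The functional `(·, y)` for a generator `y` of the cover of `U_{≤0}`. -/
def pairFun : BGen I → (Borel I →ₗ[𝕜] 𝕜)
  | .x j => Matrix.entryLinearMap 𝕜 𝕜 0 1 ∘ₗ (pairGen Ω j).toLinearMap
  | .k j => Matrix.entryLinearMap 𝕜 𝕜 0 0 ∘ₗ (pairGen Ω j).toLinearMap
  | .ki j => (pairKinv Ω j).toLinearMap

/-- `x ↦ ∑ f(x₁) x₂`, where `Δ x = ∑ x₁ ⊗ x₂`. -/
def contract (f : Borel I →ₗ[𝕜] 𝕜) : Module.End 𝕜 (Borel I) :=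
  (TensorProduct.lid 𝕜 (Borel I)).toLinearMap ∘ₗ f.rTensor (Borel I) ∘ₗ comulPos.toLinearMap

/-- `y ↦ (x ↦ ∑ (x₁, y) x₂)`.  It reverses products because `(x, y y') = ∑ (x₁, y) (x₂, y')`. -/
def contractHom : Borel I →ₐ[𝕜] (Module.End 𝕜 (Borel I))ᵐᵒᵖ :=
  FreeAlgebra.lift 𝕜 fun y => MulOpposite.op (contract (pairFun Ω y))

/-- The skew-Hopf pairing `(x, y)_φ`, on free covers of `U_{≥0}` and `U_{≤0}`. -/
def pairing : Borel I →ₗ[𝕜] Borel I →ₗ[𝕜] 𝕜 :=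
  LinearMap.mk₂ 𝕜 (fun x y => counitPos ((contractHom Ω y).unop x))
    (by intros; simp) (by intros; simp) (by intros; simp) (by intros; simp)

/-- The embedding of `'f` into the free Borel algebra. -/
def toBorel : FF I →ₐ[𝕜] Borel I := FreeAlgebra.lift 𝕜 (fun i => FreeAlgebra.ι 𝕜 (BGen.x i))

/-- The pairing `(x⁺, y⁻)_φ` for `x, y ∈ 'f`. -/
def pair : FF I →ₗ[𝕜] FF I →ₗ[𝕜] 𝕜 :=
  (pairing Ω).compl₁₂ toBorel.toLinearMap toBorel.toLinearMap

/-! ### The quasi-R-matrix -/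

/-- A choice, for every `mu ∈ ℕ[I]`, of dual bases `b`, `b*` for the nondegenerate pairing between
the degree `mu` parts of the quotients of `'f` by the left and the right radical of `(x⁺, y⁻)_φ`
(that is, of `U⁻_{-mu}` and `U⁺_mu`), given by representatives in `'f_mu`.  Linear independence of
`b`, and the fact that `b*` spans as well, follow from `dual` and `span`. -/
structure DualBases where
  n : (I → ℕ) → ℕ
  b : ∀ mu, Fin (n mu) → FF I
  bstar : ∀ mu, Fin (n mu) → FF I
  b_mem : ∀ mu k, b mu k ∈ homog mu
  bstar_mem : ∀ mu k, bstar mu k ∈ homog mu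
  dual : ∀ mu k l, pair Ω (bstar mu k) (b mu l) = if k = l then 1 else 0
  span : ∀ mu, ∀ y ∈ homog mu, ∃ c : Fin (n mu) → 𝕜,
    ∀ x ∈ homog mu, pair Ω x (y - ∑ k, c k • b mu k) = 0

/-- The homogeneous parts of `'f` are finite-dimensional. -/
theorem finiteDimensional_homog (mu : I → ℕ) : FiniteDimensional 𝕜 (homog mu) := by
  apply FiniteDimensional.span_of_finite
  refine ((List.finite_length_eq I (∑ i, mu i)).image word).subset ?_
  rintro x ⟨w, hw, rfl⟩
  refine ⟨w, ?_, rfl⟩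
  change w.length = _
  rw [← Finset.sum_congr rfl (fun i _ => hw i)]
  simpa using (Multiset.sum_count_eq_card (s := Finset.univ) (m := (w : Multiset I))
    (by intros; simp)).symm

/-- Dual bases of a bilinear form modulo its radicals. -/
theorem exists_dual_families {k V W : Type*} [Field k] [AddCommGroup V] [Module k V]
    [AddCommGroup W] [Module k W] [FiniteDimensional k V] (B : W →ₗ[k] V →ₗ[k] k) :
    ∃ (n : ℕ) (b : Fin n → W) (bs : Fin n → V),
      (∀ i j, B (b j) (bs i) = if i = j then 1 else 0) ∧
      ∀ y, ∃ c : Fin n → k, B (y - ∑ i, c i • b i) = 0 := by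
  obtain ⟨R, hR⟩ : ∃ R : Submodule k (V →ₗ[k] k), R = LinearMap.range B := ⟨_, rfl⟩
  have hmem : ∀ y, B y ∈ R := fun y => hR ▸ ⟨y, rfl⟩
  have : Module.Free k R := Module.Free.of_divisionRing k R
  let bas := Module.finBasis k R
  let ev : V →ₗ[k] Module.Dual k R := R.subtype.flip
  have hev : Function.Surjective ev := by
    rw [← LinearMap.dualMap_injective_iff, injective_iff_map_eq_zero]
    intro φ hφ
    obtain ⟨r, rfl⟩ := (Module.evalEquiv k R).surjective φ
    have hr : r = 0 := by
      apply Subtype.ext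
      ext x
      simpa [ev] using LinearMap.congr_fun hφ x
    simp [hr]
  choose b hb using fun i => (hR.le (bas i).2 : (bas i : V →ₗ[k] k) ∈ LinearMap.range B)
  choose bs hbs using fun i => hev (bas.coord i)
  refine ⟨_, b, bs, ?_, ?_⟩
  · intro i j
    have h2 : B (b j) (bs i) = ev (bs i) (bas j) := by rw [hb]; rfl
    rw [h2, hbs]
    simp [Finsupp.single_apply, eq_comm]
  · intro y
    refine ⟨fun i => bas.repr ⟨B y, hmem y⟩ i, ?_⟩
    have h := congrArg R.subtype (bas.sum_repr ⟨B y, hmem y⟩)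
    simp only [map_sum, map_smul, Submodule.subtype_apply] at h
    simp only [map_sub, map_sum, map_smul, hb]
    rw [h, sub_self]

/-- Dual bases exist. -/
theorem nonempty_dualBases : Nonempty (DualBases Ω) := by
  have key : ∀ mu : I → ℕ, ∃ (n : ℕ) (b bs : Fin n → FF I), (∀ k, b k ∈ homog mu) ∧
      (∀ k, bs k ∈ homog mu) ∧ (∀ k l, pair Ω (bs k) (b l) = if k = l then 1 else 0) ∧
      ∀ y ∈ homog mu, ∃ c : Fin n → 𝕜,
        ∀ x ∈ homog mu, pair Ω x (y - ∑ k, c k • b k) = 0 := by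
    intro mu
    have := finiteDimensional_homog mu
    obtain ⟨n, b, bs, h1, h2⟩ := exists_dual_families
      ((pair Ω).compl₁₂ (homog mu).subtype (homog mu).subtype).flip
    refine ⟨n, fun k => b k, fun k => bs k, fun k => (b k).2, fun k => (bs k).2,
      fun k l => h1 k l, fun y hy => ?_⟩
    obtain ⟨c, hc⟩ := h2 ⟨y, hy⟩
    refine ⟨c, fun x hx => ?_⟩
    simpa using LinearMap.congr_fun hc ⟨x, hx⟩
  choose n b bs h1 h2 h3 h4 using key
  exact ⟨⟨n, b, bs, h1, h2, h3, h4⟩⟩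

variable {Ω}

/-- `Θ_mu = ∑ b ⊗ b* ∈ U⁻ ⊗ U⁺`. -/
def DualBases.theta (D : DualBases Ω) (mu : I → ℕ) : U Ω ⊗[𝕜] U Ω :=
  ∑ k, minus Ω (D.b mu k) ⊗ₜ[𝕜] plus Ω (D.bstar mu k)

variable (Ω)

/-! ### Weight modules and the R-matrix -/

section Modules

variable (M : Type*) [AddCommGroup M] [Module 𝕜 M] [Module (U Ω) M] [IsScalarTower 𝕜 (U Ω) M]
variable (M' : Type*) [AddCommGroup M'] [Module 𝕜 M'] [Module (U Ω) M']
  [IsScalarTower 𝕜 (U Ω) M']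

/-- `U_{v,t}` acting on a module by `ℚ(v,t)`-linear maps. -/
def act : U Ω →ₐ[𝕜] Module.End 𝕜 M := Algebra.lsmul 𝕜 𝕜 M

/-- `c_{i,lam} = t ^ (⟨lam, i⟩ - ⟨i, lam⟩)`. -/
def cc (i : I) (lam : I → ℤ) : 𝕜 := t ^ (ang Ω lam (e i) - ang Ω (e i) lam)

/-- The weight space `M_lam`, on which `K_i` acts by `v ^ (i·lam) c_{i,lam}` and `K'_i` acts by
`v ^ (-i·lam) c_{i,lam}`. -/
def weightSpace (lam : I → ℤ) : Submodule 𝕜 M where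
  carrier := {m | ∀ i,
    gen Ω (Gen.K i) • m = (v ^ dot Ω (e i) lam * cc Ω i lam) • m ∧
    gen Ω (Gen.K' i) • m = (v ^ (-dot Ω (e i) lam) * cc Ω i lam) • m}
  zero_mem' := by intro i; simp
  add_mem' := by
    intro a b ha hb i
    simp only [smul_add, (ha i).1, (ha i).2, (hb i).1, (hb i).2, and_self]
  smul_mem' := by
    intro c a ha i
    exact ⟨by rw [smul_comm, (ha i).1, smul_comm], by rw [smul_comm, (ha i).2, smul_comm]⟩

/-- `M` is a weight module: `M = ⨁_{lam ∈ ℤ[I]} M_lam`. -/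
class IsWeightModule : Prop where
  isInternal : DirectSum.IsInternal (weightSpace Ω M)

/-- The identification of a weight module with the direct sum of its weight spaces. -/
def decomp [IsWeightModule Ω M] : (DirectSum (I → ℤ) fun lam => weightSpace Ω M lam) ≃ₗ[𝕜] M :=
  LinearEquiv.ofBijective (DirectSum.coeLinearMap (weightSpace Ω M)) IsWeightModule.isInternal

/-- `f(lam, mu) = (K_lam, K'_mu)_φ⁻¹`. -/
def f (lam mu : I → ℤ) : 𝕜 := (brace Ω lam mu)⁻¹

/-- The linear map `f̃` on `M ⊗ M'` with `f̃ (m ⊗ m') = f(lam, mu) m ⊗ m'` for `m ∈ M_lam`,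
`m' ∈ M'_mu`. -/
def ftilde [IsWeightModule Ω M] [IsWeightModule Ω M'] : M ⊗[𝕜] M' →ₗ[𝕜] M ⊗[𝕜] M' :=
  TensorProduct.lift <|
    DirectSum.toModule 𝕜 (I → ℤ) (M' →ₗ[𝕜] M ⊗[𝕜] M') (fun lam =>
      (LinearMap.flip <|
        DirectSum.toModule 𝕜 (I → ℤ) (weightSpace Ω M lam →ₗ[𝕜] M ⊗[𝕜] M') (fun mu =>
          f Ω lam mu • ((TensorProduct.mk 𝕜 M M').compl₁₂
            (weightSpace Ω M lam).subtype (weightSpace Ω M' mu).subtype).flip)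
        ∘ₗ (decomp Ω M').symm.toLinearMap))
    ∘ₗ (decomp Ω M).symm.toLinearMap

/-- The action of `U ⊗ U` on `M ⊗ M'`. -/
def actTensor : U Ω ⊗[𝕜] U Ω →ₗ[𝕜] Module.End 𝕜 (M ⊗[𝕜] M') :=
  TensorProduct.homTensorHomMap (RingHom.id 𝕜) M M' M M' ∘ₗ
    TensorProduct.map (act Ω M).toLinearMap (act Ω M').toLinearMap

variable {Ω}

/-- The operator `Θ = ∑_{mu ∈ ℕ[I]} Θ_mu` on `M ⊗ M'`; the sum is finite on finite-dimensional
weight modules by `finite_support_theta` below. -/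
def thetaOn (D : DualBases Ω) : Module.End 𝕜 (M ⊗[𝕜] M') :=
  ∑ᶠ mu : I → ℕ, actTensor Ω M M' (D.theta mu)

/-- `𝓡_{M,M'} = Θ ∘ f̃ ∘ P : M ⊗ M' → M' ⊗ M`. -/
def rmat (D : DualBases Ω) [IsWeightModule Ω M] [IsWeightModule Ω M'] :
    M ⊗[𝕜] M' →ₗ[𝕜] M' ⊗[𝕜] M :=
  thetaOn M' M D ∘ₗ ftilde Ω M' M ∘ₗ (TensorProduct.comm 𝕜 M M').toLinearMap

variable (N : Type*) [AddCommGroup N] [Module 𝕜 N] [Module (U Ω) N] [IsScalarTower 𝕜 (U Ω) N]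

/-- `𝓡₁₂ = 𝓡 ⊗ Id : M ⊗ M' ⊗ N → M' ⊗ M ⊗ N`. -/
def rmat12 (D : DualBases Ω) [IsWeightModule Ω M] [IsWeightModule Ω M'] :
    (M ⊗[𝕜] M') ⊗[𝕜] N →ₗ[𝕜] (M' ⊗[𝕜] M) ⊗[𝕜] N :=
  (rmat M M' D).rTensor N

/-- `𝓡₂₃ = Id ⊗ 𝓡 : M ⊗ M' ⊗ N → M ⊗ N ⊗ M'`. -/
def rmat23 (D : DualBases Ω) [IsWeightModule Ω M'] [IsWeightModule Ω N] :
    (M ⊗[𝕜] M') ⊗[𝕜] N →ₗ[𝕜] (M ⊗[𝕜] N) ⊗[𝕜] M' :=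
  (TensorProduct.assoc 𝕜 M N M').symm.toLinearMap ∘ₗ (rmat M' N D).lTensor M ∘ₗ
    (TensorProduct.assoc 𝕜 M M' N).toLinearMap

end Modules

/-! ### Well-definedness of `f̃` and of `Θ` -/

section WellDefined

variable {Ω}
variable {M : Type*} [AddCommGroup M] [Module 𝕜 M] [Module (U Ω) M] [IsScalarTower 𝕜 (U Ω) M]
variable {M' : Type*} [AddCommGroup M'] [Module 𝕜 M'] [Module (U Ω) M']
  [IsScalarTower 𝕜 (U Ω) M']

theorem decomp_symm_apply [IsWeightModule Ω M] (lam : I → ℤ) (m : weightSpace Ω M lam) :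
    (decomp Ω M).symm m = DirectSum.lof 𝕜 (I → ℤ) (fun lam => weightSpace Ω M lam) lam m := by
  rw [LinearEquiv.symm_apply_eq]
  exact (DirectSum.coeLinearMap_lof (weightSpace Ω M) lam m).symm

theorem ftilde_tmul [IsWeightModule Ω M] [IsWeightModule Ω M'] (lam mu : I → ℤ)
    (m : M) (hm : m ∈ weightSpace Ω M lam) (m' : M') (hm' : m' ∈ weightSpace Ω M' mu) :
    ftilde Ω M M' (m ⊗ₜ m') = f Ω lam mu • (m ⊗ₜ m') := by
  have h1 := decomp_symm_apply lam ⟨m, hm⟩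
  have h2 := decomp_symm_apply mu ⟨m', hm'⟩
  simp only at h1 h2
  simp [ftilde, h1, h2]

theorem v_ne_zero : v ≠ 0 := fun h =>
  MvPolynomial.X_ne_zero (R := ℚ) (0 : Fin 2) <|
    IsFractionRing.injective (MvPolynomial (Fin 2) ℚ) (FractionRing (MvPolynomial (Fin 2) ℚ))
      (h.trans (map_zero (algebraMap (MvPolynomial (Fin 2) ℚ)
        (FractionRing (MvPolynomial (Fin 2) ℚ)))).symm)

theorem t_ne_zero : t ≠ 0 := fun h =>
  MvPolynomial.X_ne_zero (R := ℚ) (1 : Fin 2) <|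
    IsFractionRing.injective (MvPolynomial (Fin 2) ℚ) (FractionRing (MvPolynomial (Fin 2) ℚ))
      (h.trans (map_zero (algebraMap (MvPolynomial (Fin 2) ℚ)
        (FractionRing (MvPolynomial (Fin 2) ℚ)))).symm)

theorem gen_K_mul_gen_E (i j : I) : gen Ω (Gen.K i) * gen Ω (Gen.E j) =
    (v ^ (Ω i j + Ω j i) * t ^ (Ω j i - Ω i j)) • (gen Ω (Gen.E j) * gen Ω (Gen.K i)) := by
  have h : gen Ω (Gen.K i) * gen Ω (Gen.E j) * gen Ω (Gen.Ki i) =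
      (v ^ (Ω i j + Ω j i) * t ^ (Ω j i - Ω i j)) • gen Ω (Gen.E j) := by
    simpa only [gen, map_mul, map_smul] using mkU_rel Ω (Rel.K_E i j)
  have h' : gen Ω (Gen.Ki i) * gen Ω (Gen.K i) = 1 := by
    simpa only [gen, map_mul, map_one] using mkU_rel Ω (Rel.Ki_K i)
  rw [← smul_mul_assoc, ← h, mul_assoc _ (gen Ω (Gen.Ki i)), h', mul_one]

theorem gen_K'_mul_gen_E (i j : I) : gen Ω (Gen.K' i) * gen Ω (Gen.E j) =
    (v ^ (-(Ω i j + Ω j i)) * t ^ (Ω j i - Ω i j)) •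
      (gen Ω (Gen.E j) * gen Ω (Gen.K' i)) := by
  have h : gen Ω (Gen.K' i) * gen Ω (Gen.E j) * gen Ω (Gen.Ki' i) =
      (v ^ (-(Ω i j + Ω j i)) * t ^ (Ω j i - Ω i j)) • gen Ω (Gen.E j) := by
    simpa only [gen, map_mul, map_smul] using mkU_rel Ω (Rel.K'_E i j)
  have h' : gen Ω (Gen.Ki' i) * gen Ω (Gen.K' i) = 1 := by
    simpa only [gen, map_mul, map_one] using mkU_rel Ω (Rel.Ki'_K' i)
  rw [← smul_mul_assoc, ← h, mul_assoc _ (gen Ω (Gen.Ki' i)), h', mul_one]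

set_option linter.unusedSectionVars false in
theorem ang_add_left (a b c : I → ℤ) : ang Ω (a + b) c = ang Ω a c + ang Ω b c := by
  simp [ang, add_mul, Finset.sum_add_distrib]

set_option linter.unusedSectionVars false in
theorem ang_add_right (a b c : I → ℤ) : ang Ω a (b + c) = ang Ω a b + ang Ω a c := by
  simp [ang, mul_add, Finset.sum_add_distrib]

theorem ang_e_e (i j : I) : ang Ω (e i) (e j) = Ω i j := by
  simp [ang, e, Pi.single_apply]

/-- `E_j` maps `M_lam` to `M_{lam + j}`. -/
theorem gen_E_smul_mem (j : I) (lam : I → ℤ) (m : M) (hm : m ∈ weightSpace Ω M lam) :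
    gen Ω (Gen.E j) • m ∈ weightSpace Ω M (lam + e j) := by
  intro i
  obtain ⟨h1, h2⟩ := hm i
  have hv := v_ne_zero
  have ht := t_ne_zero
  have hE (c : 𝕜) : gen Ω (Gen.E j) • c • m = c • gen Ω (Gen.E j) • m := smul_comm _ _ _
  constructor
  · rw [smul_smul, gen_K_mul_gen_E, smul_assoc (_ * _ : 𝕜) (_ * _ : U Ω) m,
      mul_smul (gen Ω (Gen.E j)), h1, hE, smul_smul, mul_mul_mul_comm, cc, cc,
      ← zpow_add₀ hv, ← zpow_add₀ ht]
    simp only [dot, ang_add_left, ang_add_right, ang_e_e]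
    congr 3 <;> ring
  · rw [smul_smul, gen_K'_mul_gen_E, smul_assoc (_ * _ : 𝕜) (_ * _ : U Ω) m,
      mul_smul (gen Ω (Gen.E j)), h2, hE, smul_smul, mul_mul_mul_comm, cc, cc,
      ← zpow_add₀ hv, ← zpow_add₀ ht]
    simp only [dot, ang_add_left, ang_add_right, ang_e_e]
    congr 3 <;> ring

theorem word_smul_mem (w : List I) (lam : I → ℤ) (m : M) (hm : m ∈ weightSpace Ω M lam) :
    plus Ω (word w) • m ∈ weightSpace Ω M (lam + fun i => (w.count i : ℤ)) := by
  induction w with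
  | nil => simpa [word, show (fun _ : I => (0 : ℤ)) = 0 from rfl] using hm
  | cons j w ih =>
    have h1 : plus Ω (word (j :: w)) = gen Ω (Gen.E j) * plus Ω (word w) := by
      simp [word, plus]
    have h2 : (lam + fun i => ((j :: w).count i : ℤ)) =
        lam + (fun i => (w.count i : ℤ)) + e j := by
      ext i
      by_cases h : i = j
      · subst h; simp [e, add_assoc]
      · simp [List.count_cons_of_ne (Ne.symm h), e, h]
    rw [h1, h2, mul_smul]
    exact gen_E_smul_mem _ _ _ ih

/-- `x⁺` maps `M_lam` to `M_{lam + mu}` for `x ∈ 'f_mu`. -/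
theorem plus_smul_mem {mu : I → ℕ} {x : FF I} (hx : x ∈ homog mu) (lam : I → ℤ) (m : M)
    (hm : m ∈ weightSpace Ω M lam) :
    plus Ω x • m ∈ weightSpace Ω M (lam + fun i => (mu i : ℤ)) := by
  induction hx using Submodule.span_induction with
  | mem x hx =>
    obtain ⟨w, hw, rfl⟩ := hx
    simpa [hw] using word_smul_mem w lam m hm
  | zero => simp
  | add x y _ _ hx hy => rw [map_add, add_smul]; exact Submodule.add_mem _ hx hy
  | smul c x _ hx => rw [map_smul, smul_assoc]; exact Submodule.smul_mem _ _ hx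

/-- Only finitely many `Θ_mu` act nontrivially on `M ⊗ M'`. -/
theorem finite_support_theta (D : DualBases Ω) [FiniteDimensional 𝕜 M'] [IsWeightModule Ω M'] :
    (Function.support fun mu : I → ℕ => actTensor Ω M M' (D.theta mu)).Finite := by
  have hint := IsWeightModule.isInternal (Ω := Ω) (M := M')
  have hfin : {lam | weightSpace Ω M' lam ≠ ⊥}.Finite :=
    WellFoundedGT.finite_ne_bot_of_iSupIndep hint.submodule_iSupIndep
  have hinj : Function.Injective (fun (mu : I → ℕ) (i : I) => (mu i : ℤ)) := by
    intro a b h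
    ext i
    exact Int.ofNat.inj (congrFun h i)
  refine ((hfin.image2 (fun a b => a - b) hfin).preimage hinj.injOn).subset ?_
  intro mu hmu
  by_contra hcon
  apply hmu
  have hz : ∀ k, act Ω M' (plus Ω (D.bstar mu k)) = 0 := by
    intro k
    have htop : (⊤ : Submodule 𝕜 M') ≤ LinearMap.ker (act Ω M' (plus Ω (D.bstar mu k))) := by
      rw [← hint.submodule_iSup_eq_top]
      refine iSup_le fun lam m hm => ?_
      by_contra hne
      have hm' := plus_smul_mem (D.bstar_mem mu k) lam m hm
      refine hcon ⟨_, ?_, lam, ?_, add_sub_cancel_left lam _⟩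
      · intro hb
        rw [hb, Submodule.mem_bot] at hm'
        exact hne hm'
      · intro hb
        rw [hb, Submodule.mem_bot] at hm
        exact hne (by rw [hm]; exact zero_mem _)
    ext m
    exact htop trivial
  simp [actTensor, DualBases.theta, hz]

end WellDefined

end TwoParam

end

noncomputable section

namespace TwoParam

section

variable {I : Type u} [Fintype I]

/-! ### The multiplicative form -/

section Brace

variable (Ω : I → I → ℤ)

/-! The relation follows Drinfeld's argument. Put `T = Θ ∘ f̃` on `M₃ ⊗ M₂`. On weight vectors both
sides reduce, up to one common scalar, to expressions in which `M₁` only meets the elements `b*`: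
one side is `T` after `(Δᵒᵖ ⊗ 1)(Θ)`, the other is `(Δ ⊗ 1)(Θ)` after `T`. They agree because `T`
intertwines `Δᵒᵖ` and `Δ`, and this is needed only for the elements `b` of `U⁻`, hence only for the
`F_i` (`theta_comm_F`, `intertwine`, `braid_apply`).

All computations with `Θ` take place in the free algebra `'f`. Left and right multiplication by
`θ_i` in the second argument of the pairing are adjoint to two skew derivations (`pair_ι_mul`,
`pair_mul_ι`), and the same derivations give the commutator of `x⁺` with `F_i` (`plus_mul_F_sub`).
Multiplication in the first argument is adjoint to the twisted coproduct (`pair_mul_word`).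

The bases `b`, `b*` are dual only modulo the radicals of the pairing, so expansions in them are
valid on a module (`Reproduces`) once the radicals act by zero. This is the hard point,
`plus_eq_zero_of_pair_eq_zero`, and it is derived from finite dimensionality rather than from the
Serre relations. If `x` of degree `mu ≠ 0` lies in the left radical, so do its skew derivatives; by
induction on the height these act by zero, so `x⁺` commutes with every `F_i`. By `sl₂`-theory an
operator that commutes with `F_i` and has positive `i`-weight vanishes (`eq_zero_of_commute_F`).
Such an `i` exists in the support of `mu` even though `Ω` need not be positive definite: the finite
set of weights of the module is stable under reflections, which yields an invariant inner product on
the span of the weights (`exists_pos_of_finite_reflections`). The right radical follows by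
exchanging `E` with `F` and transposing `Ω`. -/

theorem brace_ne_zero (a b : I → ℤ) : brace Ω a b ≠ 0 :=
  mul_ne_zero (zpow_ne_zero _ v_ne_zero) (zpow_ne_zero _ t_ne_zero)

theorem brace_add_left (a b c : I → ℤ) :
    brace Ω (a + b) c = brace Ω a c * brace Ω b c := by
  classical
  simp only [brace, dot, ang_add_left, ang_add_right]
  rw [mul_mul_mul_comm, ← zpow_add₀ v_ne_zero, ← zpow_add₀ t_ne_zero]
  congr 2 <;> ring

theorem brace_add_right (a b c : I → ℤ) :
    brace Ω a (b + c) = brace Ω a b * brace Ω a c := by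
  classical
  simp only [brace, dot, ang_add_left, ang_add_right]
  rw [mul_mul_mul_comm, ← zpow_add₀ v_ne_zero, ← zpow_add₀ t_ne_zero]
  congr 2 <;> ring

@[simp] theorem brace_zero_left (b : I → ℤ) : brace Ω 0 b = 1 := by
  simp [brace, dot, ang]

@[simp] theorem brace_zero_right (b : I → ℤ) : brace Ω b 0 = 1 := by
  simp [brace, dot, ang]

theorem brace_neg_left (a b : I → ℤ) : brace Ω (-a) b = (brace Ω a b)⁻¹ := by
  apply eq_inv_of_mul_eq_one_left
  rw [← brace_add_left]; simp

theorem brace_neg_right (a b : I → ℤ) : brace Ω a (-b) = (brace Ω a b)⁻¹ := by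
  apply eq_inv_of_mul_eq_one_left
  rw [← brace_add_right]; simp

theorem brace_sub_left (a b c : I → ℤ) :
    brace Ω (a - b) c = brace Ω a c * (brace Ω b c)⁻¹ := by
  rw [sub_eq_add_neg, brace_add_left, brace_neg_left]

theorem brace_sub_right (a b c : I → ℤ) :
    brace Ω a (b - c) = brace Ω a b * (brace Ω a c)⁻¹ := by
  rw [sub_eq_add_neg, brace_add_right, brace_neg_right]

/-- The transposed Cartan datum. -/
def transp : I → I → ℤ := fun i j => Ω j i

theorem ang_transp (a b : I → ℤ) : ang (transp Ω) a b = ang Ω b a := by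
  simp only [ang, transp]
  rw [Finset.sum_comm]
  refine Finset.sum_congr rfl fun i _ => Finset.sum_congr rfl fun j _ => by ring

theorem brace_transp (a b : I → ℤ) : brace (transp Ω) a b = brace Ω b a := by
  simp only [brace, dot, ang_transp, add_comm]

omit [Fintype I] in
theorem vi_transp (i : I) : vi (transp Ω) i = vi Ω i := rfl

theorem IsCartan.transp {Ω : I → I → ℤ} (h : IsCartan Ω) : IsCartan (transp Ω) where
  diag_pos := h.diag_pos
  offdiag_nonpos i j hij := h.offdiag_nonpos j i hij.symm
  dvd i j hij := by
    have := h.dvd i j hij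
    simpa only [TwoParam.transp, add_comm] using this
  gcd_eq_one := h.gcd_eq_one

end Brace

/-! ### `v` is not a root of unity -/

theorem v_pow_ne_one {n : ℕ} (hn : n ≠ 0) : v ^ n ≠ 1 := by
  intro h
  have h1 : algebraMap (MvPolynomial (Fin 2) ℚ) (FractionRing (MvPolynomial (Fin 2) ℚ))
      (MvPolynomial.X 0 ^ n) = algebraMap _ _ 1 := by
    rw [map_pow, map_one]; exact h
  have h2 := IsFractionRing.injective (MvPolynomial (Fin 2) ℚ)
    (FractionRing (MvPolynomial (Fin 2) ℚ)) h1
  -- Evaluating both indeterminates at `2` turns the identity into `2 ^ n = 1`.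
  have h3 := congrArg (MvPolynomial.eval fun _ => (2 : ℚ)) h2
  simp only [map_pow, MvPolynomial.eval_X, map_one] at h3
  exact hn ((pow_eq_one_iff_of_nonneg (by norm_num) hn).not.2 (by norm_num) h3).elim

theorem v_zpow_ne_one {n : ℤ} (hn : n ≠ 0) : v ^ n ≠ 1 := by
  intro h
  rcases Int.natAbs_eq n with h' | h'
  · rw [h', zpow_natCast] at h
    exact v_pow_ne_one (by omega) h
  · rw [h', zpow_neg, zpow_natCast, inv_eq_one] at h
    exact v_pow_ne_one (by omega) h

section VI

variable {Ω : I → I → ℤ} (hΩ : IsCartan Ω)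
include hΩ

theorem vi_zpow_ne_one (i : I) {n : ℤ} (hn : n ≠ 0) : vi Ω i ^ n ≠ 1 := by
  rw [vi, ← zpow_mul]
  exact v_zpow_ne_one (mul_ne_zero (hΩ.diag_pos i).ne' hn)

theorem vi_sub_inv_ne_zero (i : I) : vi Ω i - (vi Ω i)⁻¹ ≠ 0 := by
  intro h
  have h0 : vi Ω i ≠ 0 := zpow_ne_zero _ v_ne_zero
  have h1 : vi Ω i ^ (2 : ℤ) = 1 := by
    have : vi Ω i = (vi Ω i)⁻¹ := sub_eq_zero.1 h
    rw [zpow_ofNat, pow_two]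
    nth_rewrite 2 [this]
    exact mul_inv_cancel₀ h0
  exact vi_zpow_ne_one hΩ i two_ne_zero h1

end VI

/-! ### Words -/

section Words

omit [Fintype I]

@[simp] theorem word_nil : word ([] : List I) = 1 := rfl

theorem word_cons (i : I) (w : List I) : word (i :: w) = FreeAlgebra.ι 𝕜 i * word w := by
  simp [word]

theorem word_append (a b : List I) : word (a ++ b) = word a * word b := by
  simp [word]

theorem span_words : Submodule.span 𝕜 (Set.range (word (I := I))) = ⊤ := by
  rw [eq_top_iff]
  rintro x -
  induction x using FreeAlgebra.induction with
  | grade0 r =>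
    rw [Algebra.algebraMap_eq_smul_one]
    exact Submodule.smul_mem _ _ (Submodule.subset_span ⟨[], rfl⟩)
  | grade1 i => exact Submodule.subset_span ⟨[i], by simp [word]⟩
  | add x y hx hy => exact Submodule.add_mem _ hx hy
  | mul x y hx hy =>
    have h := Submodule.mul_mem_mul hx hy
    rw [Submodule.span_mul_span] at h
    refine Submodule.span_mono ?_ h
    rintro _ ⟨_, ⟨a, rfl⟩, _, ⟨b, rfl⟩, rfl⟩
    exact ⟨a ++ b, word_append a b⟩

theorem linearMap_ext_word {N : Type*} [AddCommMonoid N] [Module 𝕜 N] {f g : FF I →ₗ[𝕜] N}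
    (h : ∀ w, f (word w) = g (word w)) : f = g :=
  LinearMap.ext_on_range span_words h

variable [DecidableEq I]

/-- The degree of a word. -/
def wdeg (w : List I) : I → ℤ := fun i => (w.count i : ℤ)

@[simp] theorem wdeg_nil : wdeg ([] : List I) = 0 := by ext; simp [wdeg]

theorem wdeg_cons (i : I) (w : List I) : wdeg (i :: w) = wdeg w + e i := by
  ext k
  by_cases h : k = i
  · subst h; simp [wdeg, e]
  · simp [wdeg, List.count_cons_of_ne (Ne.symm h), e, h]

theorem word_mem_homog (w : List I) : word w ∈ homog (fun i => w.count i) :=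
  Submodule.subset_span ⟨w, fun _ => rfl, rfl⟩

theorem ι_mul_mem_homog (j : I) {mu nu : I → ℕ} (h : ∀ k, nu k = mu k + if k = j then 1 else 0)
    {x : FF I} (hx : x ∈ homog mu) : FreeAlgebra.ι 𝕜 j * x ∈ homog nu := by
  induction hx using Submodule.span_induction with
  | mem x hx =>
    obtain ⟨w, hw, rfl⟩ := hx
    refine Submodule.subset_span ⟨j :: w, fun k => ?_, (word_cons j w).symm⟩
    rw [List.count_cons, hw, h]
    by_cases hk : k = j
    · simp [hk]
    · simp [hk, Ne.symm hk]
  | zero => simp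
  | add x y _ _ hx hy => rw [mul_add]; exact Submodule.add_mem _ hx hy
  | smul c x _ hx => rw [mul_smul_comm]; exact Submodule.smul_mem _ _ hx

end Words

end

section

variable {I : Type u} [Fintype I] [DecidableEq I] (Ω : I → I → ℤ)

/-! ### Skew derivations of `'f` -/

/-- The automorphism `θ_j ↦ {j, i} θ_j` of `'f`. -/
def twistL (i : I) : FF I →ₐ[𝕜] FF I :=
  FreeAlgebra.lift 𝕜 fun j => brace Ω (e j) (e i) • FreeAlgebra.ι 𝕜 j

/-- The automorphism `θ_j ↦ {i, j} θ_j` of `'f`. -/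
def twistR (i : I) : FF I →ₐ[𝕜] FF I :=
  FreeAlgebra.lift 𝕜 fun j => brace Ω (e i) (e j) • FreeAlgebra.ι 𝕜 j

/-- The homomorphism `x ↦ !![twistL x, derL x; 0, x]`. -/
def derLMat (i : I) : FF I →ₐ[𝕜] Matrix (Fin 2) (Fin 2) (FF I) :=
  FreeAlgebra.lift 𝕜 fun j =>
    !![brace Ω (e j) (e i) • FreeAlgebra.ι 𝕜 j, if j = i then 1 else 0; 0, FreeAlgebra.ι 𝕜 j]

/-- The homomorphism `x ↦ !![x, derR x; 0, twistR x]`. -/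
def derRMat (i : I) : FF I →ₐ[𝕜] Matrix (Fin 2) (Fin 2) (FF I) :=
  FreeAlgebra.lift 𝕜 fun j =>
    !![FreeAlgebra.ι 𝕜 j, if j = i then 1 else 0; 0, brace Ω (e i) (e j) • FreeAlgebra.ι 𝕜 j]

/-- The skew derivation with `derL (x y) = twistL x * derL y + derL x * y`. -/
def derL (i : I) : FF I →ₗ[𝕜] FF I :=
  Matrix.entryLinearMap 𝕜 (FF I) 0 1 ∘ₗ (derLMat Ω i).toLinearMap

/-- The skew derivation with `derR (x y) = x * derR y + derR x * twistR y`. -/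
def derR (i : I) : FF I →ₗ[𝕜] FF I :=
  Matrix.entryLinearMap 𝕜 (FF I) 0 1 ∘ₗ (derRMat Ω i).toLinearMap

@[simp] theorem twistL_ι (i j : I) :
    twistL Ω i (FreeAlgebra.ι 𝕜 j) = brace Ω (e j) (e i) • FreeAlgebra.ι 𝕜 j := by
  simp [twistL]

@[simp] theorem twistR_ι (i j : I) :
    twistR Ω i (FreeAlgebra.ι 𝕜 j) = brace Ω (e i) (e j) • FreeAlgebra.ι 𝕜 j := by
  simp [twistR]

theorem derLMat_apply (i : I) (x : FF I) :
    derLMat Ω i x 0 0 = twistL Ω i x ∧ derLMat Ω i x 1 0 = 0 ∧ derLMat Ω i x 1 1 = x := by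
  induction x using FreeAlgebra.induction with
  | grade0 r => simp [Algebra.algebraMap_eq_smul_one]
  | grade1 j => simp [derLMat]
  | add x y hx hy => simp [hx, hy]
  | mul x y hx hy => simp [Matrix.mul_apply, Fin.sum_univ_two, hx, hy]

theorem derRMat_apply (i : I) (x : FF I) :
    derRMat Ω i x 0 0 = x ∧ derRMat Ω i x 1 0 = 0 ∧ derRMat Ω i x 1 1 = twistR Ω i x := by
  induction x using FreeAlgebra.induction with
  | grade0 r => simp [Algebra.algebraMap_eq_smul_one]
  | grade1 j => simp [derRMat]
  | add x y hx hy => simp [hx, hy]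
  | mul x y hx hy => simp [Matrix.mul_apply, Fin.sum_univ_two, hx, hy]

theorem derL_mul (i : I) (x y : FF I) :
    derL Ω i (x * y) = twistL Ω i x * derL Ω i y + derL Ω i x * y := by
  simp [derL, Matrix.mul_apply, Fin.sum_univ_two, derLMat_apply]

theorem derR_mul (i : I) (x y : FF I) :
    derR Ω i (x * y) = x * derR Ω i y + derR Ω i x * twistR Ω i y := by
  simp [derR, Matrix.mul_apply, Fin.sum_univ_two, derRMat_apply]

@[simp] theorem derL_one (i : I) : derL Ω i 1 = 0 := by simp [derL]

@[simp] theorem derR_one (i : I) : derR Ω i 1 = 0 := by simp [derR]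

@[simp] theorem derL_ι (i j : I) : derL Ω i (FreeAlgebra.ι 𝕜 j) = if j = i then 1 else 0 := by
  simp [derL, derLMat]

@[simp] theorem derR_ι (i j : I) : derR Ω i (FreeAlgebra.ι 𝕜 j) = if j = i then 1 else 0 := by
  simp [derR, derRMat]

theorem derL_ι_mul (i j : I) (x : FF I) : derL Ω i (FreeAlgebra.ι 𝕜 j * x) =
    brace Ω (e j) (e i) • (FreeAlgebra.ι 𝕜 j * derL Ω i x) + if j = i then x else 0 := by
  simp [derL_mul]

theorem derR_ι_mul (i j : I) (x : FF I) : derR Ω i (FreeAlgebra.ι 𝕜 j * x) =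
    FreeAlgebra.ι 𝕜 j * derR Ω i x + if j = i then twistR Ω i x else 0 := by
  simp [derR_mul]

theorem derL_twistL (i j : I) (x : FF I) :
    derL Ω j (twistL Ω i x) = brace Ω (e j) (e i) • twistL Ω i (derL Ω j x) := by
  suffices h : derL Ω j ∘ₗ (twistL Ω i).toLinearMap =
      brace Ω (e j) (e i) • ((twistL Ω i).toLinearMap ∘ₗ derL Ω j) from LinearMap.congr_fun h x
  refine linearMap_ext_word fun w => ?_
  induction w with
  | nil => simp
  | cons k w ih =>
    simp only [LinearMap.comp_apply, AlgHom.toLinearMap_apply, LinearMap.smul_apply] at ih ⊢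
    rw [word_cons, map_mul, twistL_ι, smul_mul_assoc, map_smul, derL_ι_mul, ih, derL_ι_mul]
    by_cases hk : k = j
    · subst hk
      simp [smul_smul, mul_comm]
    · simp [hk, smul_smul, mul_comm, mul_left_comm]

theorem derL_twistR (i j : I) (x : FF I) :
    derL Ω j (twistR Ω i x) = brace Ω (e i) (e j) • twistR Ω i (derL Ω j x) := by
  suffices h : derL Ω j ∘ₗ (twistR Ω i).toLinearMap =
      brace Ω (e i) (e j) • ((twistR Ω i).toLinearMap ∘ₗ derL Ω j) from LinearMap.congr_fun h x
  refine linearMap_ext_word fun w => ?_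
  induction w with
  | nil => simp
  | cons k w ih =>
    simp only [LinearMap.comp_apply, AlgHom.toLinearMap_apply, LinearMap.smul_apply] at ih ⊢
    rw [word_cons, map_mul, twistR_ι, smul_mul_assoc, map_smul, derL_ι_mul, ih, derL_ι_mul]
    by_cases hk : k = j
    · subst hk
      simp [smul_smul, mul_comm]
    · simp [hk, smul_smul, mul_comm, mul_left_comm]

/-- Removing a letter from the left and removing one from the right commute, twists included: the
scalar by which `derL` fails to commute with `twistR` is the one produced by the Leibniz rule. This
is the inductive step of `pair_mul_ι`. -/
theorem derL_derR (i j : I) (x : FF I) : derL Ω j (derR Ω i x) = derR Ω i (derL Ω j x) := by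
  suffices h : derL Ω j ∘ₗ derR Ω i = derR Ω i ∘ₗ derL Ω j from LinearMap.congr_fun h x
  refine linearMap_ext_word fun w => ?_
  induction w with
  | nil => simp
  | cons k w ih =>
    simp only [LinearMap.comp_apply] at ih ⊢
    rw [word_cons, derR_ι_mul, map_add, derL_ι_mul, ih, derL_ι_mul, map_add, map_smul, derR_ι_mul]
    by_cases hi : k = i
    · by_cases hj : k = j
      · subst hi; subst hj; simp [derL_twistR]; abel
      · subst hi; simp [hj, derL_twistR]
    · by_cases hj : k = j
      · subst hj; simp [hi]
      · simp [hi, hj]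

theorem derL_word_of_notMem (i : I) (w : List I) (h : i ∉ w) : derL Ω i (word w) = 0 := by
  induction w with
  | nil => simp
  | cons j w ih =>
    rw [List.mem_cons, not_or] at h
    rw [word_cons, derL_ι_mul, ih h.2]
    simp [Ne.symm h.1]

theorem derR_word_of_notMem (i : I) (w : List I) (h : i ∉ w) : derR Ω i (word w) = 0 := by
  induction w with
  | nil => simp
  | cons j w ih =>
    rw [List.mem_cons, not_or] at h
    rw [word_cons, derR_ι_mul, ih h.2]
    simp [Ne.symm h.1]

theorem twistR_word (i : I) (w : List I) :
    twistR Ω i (word w) = brace Ω (e i) (wdeg w) • word w := by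
  induction w with
  | nil => simp
  | cons j w ih =>
    rw [word_cons, map_mul, ih, twistR_ι, wdeg_cons, brace_add_right, smul_mul_smul_comm, mul_comm]

/-- Each term of the derivative is `w` with one letter `i` removed. When `i` does not occur, `erase`
changes nothing, but then the derivative is zero. -/
theorem derL_word_mem (i : I) (w : List I) :
    derL Ω i (word w) ∈ homog (fun k => (w.erase i).count k) := by
  induction w with
  | nil => simp
  | cons j w ih =>
    rw [word_cons, derL_ι_mul]
    refine Submodule.add_mem _ (Submodule.smul_mem _ _ ?_) ?_
    · by_cases hi : i ∈ w
      · refine ι_mul_mem_homog j (fun k => ?_) ih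
        by_cases hj : j = i
        · subst hj
          rw [List.erase_cons_head, List.count_erase]
          by_cases hk : k = j
          · subst hk
            have := List.count_pos_iff.2 hi
            simp; omega
          · simp [hk, Ne.symm hk]
        · rw [List.erase_cons_tail (by simpa using hj), List.count_cons]
          by_cases hk : k = j
          · simp [hk]
          · simp [hk, Ne.symm hk]
      · rw [derL_word_of_notMem Ω i w hi]; simp
    · split_ifs with hj
      · subst hj
        rw [List.erase_cons_head]
        exact word_mem_homog w
      · exact zero_mem _

theorem derR_word_mem (i : I) (w : List I) :
    derR Ω i (word w) ∈ homog (fun k => (w.erase i).count k) := by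
  induction w with
  | nil => simp
  | cons j w ih =>
    rw [word_cons, derR_ι_mul]
    refine Submodule.add_mem _ ?_ ?_
    · by_cases hi : i ∈ w
      · refine ι_mul_mem_homog j (fun k => ?_) ih
        by_cases hj : j = i
        · subst hj
          rw [List.erase_cons_head, List.count_erase]
          by_cases hk : k = j
          · subst hk
            have := List.count_pos_iff.2 hi
            simp; omega
          · simp [hk, Ne.symm hk]
        · rw [List.erase_cons_tail (by simpa using hj), List.count_cons]
          by_cases hk : k = j
          · simp [hk]
          · simp [hk, Ne.symm hk]
      · rw [derR_word_of_notMem Ω i w hi]; simp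
    · split_ifs with hj
      · subst hj
        rw [List.erase_cons_head, twistR_word]
        exact Submodule.smul_mem _ _ (word_mem_homog w)
      · exact zero_mem _

/-! ### Recursions for the pairing -/

/-- `(E_i, F_i)_φ`. -/
def pairC (i : I) : 𝕜 := ((vi Ω i)⁻¹ - vi Ω i)⁻¹

omit [Fintype I] [DecidableEq I] in
theorem counit_comulPos (z : Borel I) :
    TensorProduct.lid 𝕜 (Borel I) (counitPos.toLinearMap.rTensor (Borel I) (comulPos z)) = z := by
  suffices h : (Algebra.TensorProduct.lid 𝕜 (Borel I)).toAlgHom.comp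
      ((Algebra.TensorProduct.map counitPos (AlgHom.id 𝕜 (Borel I))).comp comulPos) =
      AlgHom.id 𝕜 (Borel I) from DFunLike.congr_fun h z
  ext j
  cases j <;> simp [comulPos, counitPos]

theorem pairGen_apply (i : I) (z : Borel I) :
    pairGen Ω i z 1 0 = 0 ∧ pairGen Ω i z 1 1 = counitPos z := by
  induction z using FreeAlgebra.induction with
  | grade0 r => simp [Algebra.algebraMap_eq_smul_one]
  | grade1 j => cases j <;> simp [pairGen, counitPos]
  | add x y hx hy => simp [hx, hy]
  | mul x y hx hy => simp [Matrix.mul_apply, Fin.sum_univ_two, hx, hy]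

/-- In `(E_j ⊗ 1 + K_j ⊗ E_j) Δ(z)` the first leg is paired with `F_i`. The first summand gives the
pairing constant times the counit of the remaining first leg, and the counit axiom restores `z`; the
second gives `{j, i}` times the contraction of `z`. -/
theorem contract_x_mul (i j : I) (z : Borel I) :
    contract (pairFun Ω (.x i)) (FreeAlgebra.ι 𝕜 (.x j) * z) =
      brace Ω (e j) (e i) • (FreeAlgebra.ι 𝕜 (.x j) * contract (pairFun Ω (.x i)) z) +
      if j = i then pairC Ω i • z else 0 := by
  -- Replacing `Δ(z)` by an arbitrary tensor allows a check on pure tensors.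
  have key (s : Borel I ⊗[𝕜] Borel I) :
      TensorProduct.lid 𝕜 (Borel I) ((pairFun Ω (.x i)).rTensor (Borel I)
        (comulPos (FreeAlgebra.ι 𝕜 (.x j)) * s)) =
      brace Ω (e j) (e i) • (FreeAlgebra.ι 𝕜 (.x j) *
        TensorProduct.lid 𝕜 (Borel I) ((pairFun Ω (.x i)).rTensor (Borel I) s)) +
      if j = i then pairC Ω i •
        TensorProduct.lid 𝕜 (Borel I) (counitPos.toLinearMap.rTensor (Borel I) s) else 0 := by
    induction s with
    | zero => simp
    | add x y hx hy =>
      rw [mul_add, map_add, map_add, hx, hy, map_add, map_add, map_add, map_add, mul_add]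
      split_ifs <;> simp only [smul_add] <;> abel
    | tmul a b =>
      have hx : pairFun Ω (.x i) (FreeAlgebra.ι 𝕜 (.x j) * a) =
          if j = i then pairC Ω i * counitPos a else 0 := by
        by_cases h : j = i
        · subst h
          simp [pairFun, Matrix.mul_apply, Fin.sum_univ_two, pairGen_apply, pairC]
          simp [pairGen]
        · simp [pairFun, Matrix.mul_apply, Fin.sum_univ_two, h]
          simp [pairGen, h]
      have hk : pairFun Ω (.x i) (FreeAlgebra.ι 𝕜 (.k j) * a) =
          brace Ω (e j) (e i) * pairFun Ω (.x i) a := by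
        simp [pairFun, Matrix.mul_apply, Fin.sum_univ_two]
        simp [pairGen]
      have hc : comulPos (FreeAlgebra.ι 𝕜 (BGen.x j)) = FreeAlgebra.ι 𝕜 (.x j) ⊗ₜ[𝕜] 1 +
          FreeAlgebra.ι 𝕜 (.k j) ⊗ₜ[𝕜] FreeAlgebra.ι 𝕜 (.x j) := by
        simp [comulPos]
      rw [hc]
      simp only [add_mul, Algebra.TensorProduct.tmul_mul_tmul, map_add, LinearMap.rTensor_tmul,
        TensorProduct.lid_tmul, hx, hk, one_mul, AlgHom.toLinearMap_apply]
      split_ifs <;> simp [smul_smul, add_comm]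
  have := key (comulPos z)
  rw [← map_mul, counit_comulPos] at this
  exact this

theorem contract_toBorel (i : I) (x : FF I) :
    contract (pairFun Ω (.x i)) (toBorel x) = pairC Ω i • toBorel (derL Ω i x) := by
  suffices h : contract (pairFun Ω (.x i)) ∘ₗ toBorel.toLinearMap =
      pairC Ω i • (toBorel.toLinearMap ∘ₗ derL Ω i) from LinearMap.congr_fun h x
  refine linearMap_ext_word fun w => ?_
  induction w with
  | nil =>
    simp [contract, pairFun, Algebra.TensorProduct.one_def]
  | cons j w ih =>
    simp only [LinearMap.comp_apply, AlgHom.toLinearMap_apply, LinearMap.smul_apply] at ih ⊢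
    have h : toBorel (FreeAlgebra.ι 𝕜 j) = FreeAlgebra.ι 𝕜 (BGen.x j) := by simp [toBorel]
    rw [word_cons, map_mul, h, contract_x_mul, ih, derL_ι_mul, map_add, map_smul, map_mul, h]
    split_ifs <;> simp [smul_smul, mul_comm]

/-- The augmentation of `'f`. -/
def aug : FF I →ₐ[𝕜] 𝕜 := FreeAlgebra.lift 𝕜 fun _ => 0

theorem pair_one (x : FF I) : pair Ω x 1 = aug x := by
  have h : (counitPos.comp toBorel : FF I →ₐ[𝕜] 𝕜) = aug := by
    ext i; simp [toBorel, counitPos, aug]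
  simp [pair, pairing, ← h]

theorem pair_ι_mul (i : I) (x y : FF I) :
    pair Ω x (FreeAlgebra.ι 𝕜 i * y) = pairC Ω i * pair Ω (derL Ω i x) y := by
  have h : toBorel (FreeAlgebra.ι 𝕜 i) = FreeAlgebra.ι 𝕜 (BGen.x i) := by simp [toBorel]
  have h2 : contractHom Ω (FreeAlgebra.ι 𝕜 (BGen.x i)) =
    MulOpposite.op (contract (pairFun Ω (.x i))) := by simp [contractHom]
  simp [pair, pairing, h, h2, contract_toBorel]

omit [Fintype I] [DecidableEq I] in
@[simp] theorem aug_ι (i : I) : aug (FreeAlgebra.ι 𝕜 i) = 0 := by simp [aug]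

/-- On a word that starts with `j`, both sides reduce to `δ_ij` times the augmentation of the tail.
This is the base case of `pair_mul_ι`. -/
theorem aug_derL (i : I) (x : FF I) : aug (derL Ω i x) = aug (derR Ω i x) := by
  suffices h : aug.toLinearMap ∘ₗ derL Ω i = aug.toLinearMap ∘ₗ derR Ω i from
    LinearMap.congr_fun h x
  refine linearMap_ext_word fun w => ?_
  cases w with
  | nil => simp
  | cons j w =>
    have ht : aug (twistR Ω i (word w)) = aug (word w) := by
      have : aug.comp (twistR Ω i) = aug := by ext; simp
      exact DFunLike.congr_fun this _
    simp [word_cons, derL_ι_mul, derR_ι_mul]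
    split_ifs <;> simp [ht]

/-- The pairing is built by stripping letters of the second argument from the left. Since `derR`
commutes with `derL`, the last letter can be carried through all the others until it stands alone.
-/
theorem pair_mul_ι (i : I) (x y : FF I) :
    pair Ω x (y * FreeAlgebra.ι 𝕜 i) = pairC Ω i * pair Ω (derR Ω i x) y := by
  suffices h : ∀ w x, pair Ω x (word w * FreeAlgebra.ι 𝕜 i) =
      pairC Ω i * pair Ω (derR Ω i x) (word w) by
    have h2 : pair Ω x ∘ₗ LinearMap.mulRight 𝕜 (FreeAlgebra.ι 𝕜 i) =
        pairC Ω i • pair Ω (derR Ω i x) := linearMap_ext_word fun w => by simpa using h w x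
    simpa using LinearMap.congr_fun h2 y
  intro w
  induction w with
  | nil =>
    intro x
    have := pair_ι_mul Ω i x 1
    rw [mul_one] at this
    rw [word_nil, one_mul, this, pair_one, pair_one, aug_derL]
  | cons j w ih =>
    intro x
    rw [word_cons, mul_assoc, pair_ι_mul, ih, pair_ι_mul, derL_derR]
    ring

/-- For the transposed datum, left multiplication by `θ_i` in the first argument is adjoint to `derL
Ω i` in the second, so both sides obey the same recursion. Together with `swap` this transfers
results from `U⁺` to `U⁻`. -/
theorem pair_transp (x y : FF I) : pair (transp Ω) y x = pair Ω x y := by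
  have h1 (x y : FF I) (i : I) : pair (transp Ω) (FreeAlgebra.ι 𝕜 i * y) x =
      pairC Ω i * pair (transp Ω) y (derL Ω i x) := by
    suffices h : ∀ w y, pair (transp Ω) (FreeAlgebra.ι 𝕜 i * y) (word w) =
        pairC Ω i * pair (transp Ω) y (derL Ω i (word w)) by
      have h2 : pair (transp Ω) (FreeAlgebra.ι 𝕜 i * y) =
          pairC Ω i • (pair (transp Ω) y ∘ₗ derL Ω i) :=
        linearMap_ext_word fun w => by simpa using h w y
      simpa using LinearMap.congr_fun h2 x
    intro w
    induction w with
    | nil => intro y; simp [pair_one]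
    | cons j w ih =>
      intro y
      rw [word_cons, pair_ι_mul, derL_ι_mul, derL_ι_mul, map_add, map_smul, LinearMap.add_apply,
        LinearMap.smul_apply, ih, map_add, map_smul, pair_ι_mul, brace_transp]
      by_cases hij : i = j
      · subst hij
        simp only [if_true, smul_eq_mul]
        simp only [pairC, vi_transp]
      · simp only [if_neg hij, if_neg (Ne.symm hij), smul_eq_mul, map_zero, LinearMap.zero_apply]
        ring
  suffices h : ∀ w x, pair (transp Ω) (word w) x = pair Ω x (word w) by
    have h2 : (pair (transp Ω)).flip x = pair Ω x :=
      linearMap_ext_word fun w => by simpa using h w x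
    simpa using LinearMap.congr_fun h2 y
  intro w
  induction w with
  | nil =>
    intro x
    suffices h : pair (transp Ω) (word []) = (pair Ω).flip 1 from LinearMap.congr_fun h x
    refine linearMap_ext_word fun w => ?_
    cases w with
    | nil => simp [pair_one]
    | cons i w => simp [word_cons, pair_ι_mul, pair_one]
  | cons i w ih =>
    intro x
    rw [word_cons, h1, ih, pair_ι_mul]

theorem pair_word_eq_zero (w w' : List I) (h : ∃ k, w.count k ≠ w'.count k) :
    pair Ω (word w) (word w') = 0 := by
  -- The first argument must be a general homogeneous element, because `derL` of a word is no longer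
  -- a word.
  suffices key : ∀ (w' : List I) (mu : I → ℕ), ∀ x ∈ homog mu, (∃ k, mu k ≠ w'.count k) →
      pair Ω x (word w') = 0 from key w' _ _ (word_mem_homog w) h
  clear h w w'
  intro w'
  induction w' with
  | nil =>
    rintro mu x hx ⟨k, hk⟩
    rw [word_nil, pair_one]
    induction hx using Submodule.span_induction with
    | mem x hx =>
      obtain ⟨w, hw, rfl⟩ := hx
      cases w with
      | nil => exact absurd (hw k).symm hk
      | cons i w => simp [word_cons]
    | zero => simp
    | add x y _ _ hx hy => rw [map_add, hx, hy, add_zero]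
    | smul c x _ hx => rw [map_smul, hx, smul_zero]
  | cons i w' ih =>
    rintro mu x hx ⟨k, hk⟩
    rw [word_cons, pair_ι_mul]
    induction hx using Submodule.span_induction with
    | mem x hx =>
      obtain ⟨w, hw, rfl⟩ := hx
      by_cases hi : i ∈ w
      · rw [ih _ _ (derL_word_mem Ω i w), mul_zero]
        refine ⟨k, fun h => hk ?_⟩
        rw [← hw k, List.count_cons, ← h, List.count_erase]
        have := List.count_pos_iff.2 hi
        by_cases hki : i = k
        · subst hki; simp; omega
        · simp [hki]
      · rw [derL_word_of_notMem Ω i w hi]; simp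
    | zero => simp
    | add x y _ _ hx hy => rw [map_add, map_add, LinearMap.add_apply, mul_add, hx, hy, add_zero]
    | smul c x _ hx =>
      rw [map_smul, map_smul, LinearMap.smul_apply, smul_eq_mul, mul_left_comm, hx, mul_zero]

theorem pair_homog_eq_zero {mu nu : I → ℕ} (h : mu ≠ nu) {x y : FF I} (hx : x ∈ homog mu)
    (hy : y ∈ homog nu) : pair Ω x y = 0 := by
  induction hx using Submodule.span_induction with
  | mem x hx =>
    obtain ⟨w, hw, rfl⟩ := hx
    induction hy using Submodule.span_induction with
    | mem y hy =>
      obtain ⟨w', hw', rfl⟩ := hy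
      refine pair_word_eq_zero Ω w w' ?_
      by_contra! hcon
      exact h (funext fun k => by rw [← hw, ← hw', hcon])
    | zero => simp
    | add x y _ _ hx hy => rw [map_add, hx, hy, add_zero]
    | smul c x _ hx => rw [map_smul, hx, smul_zero]
  | zero => simp
  | add x y _ _ hx hy => rw [map_add, LinearMap.add_apply, hx, hy, add_zero]
  | smul c x _ hx => rw [map_smul, LinearMap.smul_apply, hx, smul_zero]

/-! ### The twisted coproduct of a word -/

/-- The terms `c • a ⊗ b` of the twisted coproduct of a word. -/
def splits : List I → List (𝕜 × List I × List I)
  | [] => [(1, [], [])]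
  | i :: w =>
    (splits w).map (fun p => (p.1, i :: p.2.1, p.2.2)) ++
      (splits w).map (fun p => (brace Ω (wdeg p.2.1) (e i) * p.1, p.2.1, i :: p.2.2))

/-- Only the component of `x` in the degree of `w` pairs nontrivially with `w`, and on it `twistL`
is this scalar. -/
theorem pair_twistL (i : I) (w : List I) : ∀ x,
    pair Ω (twistL Ω i x) (word w) = brace Ω (wdeg w) (e i) * pair Ω x (word w) := by
  induction w with
  | nil =>
    intro x
    have : aug.comp (twistL Ω i) = aug := by ext; simp
    simpa [pair_one] using DFunLike.congr_fun this x
  | cons j w ih =>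
    intro x
    rw [word_cons, pair_ι_mul, derL_twistL, map_smul, LinearMap.smul_apply, ih, pair_ι_mul,
      wdeg_cons, brace_add_left, smul_eq_mul]
    ring

/-- Dual to the Leibniz rule of `derL`: a letter taken from `x` goes to the left word of a split,
and a letter taken from `x'` goes to the right word, at the cost of twisting `x`. -/
theorem pair_mul_word (w : List I) : ∀ x x' : FF I, pair Ω (x * x') (word w) =
    ((splits Ω w).map fun p =>
      p.1 * (pair Ω x (word p.2.1) * pair Ω x' (word p.2.2))).sum := by
  induction w with
  | nil => intro x x'; simp [splits, pair_one]
  | cons i w ih =>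
    intro x x'
    rw [word_cons, pair_ι_mul, derL_mul, map_add, LinearMap.add_apply, ih, ih, splits,
      List.map_append, List.sum_append, List.map_map, List.map_map, mul_add, add_comm]
    congr 1
    · rw [← List.sum_map_mul_left]
      congr 1
      refine List.map_congr_left fun p _ => ?_
      simp only [Function.comp, word_cons, pair_ι_mul]
      ring
    · rw [← List.sum_map_mul_left]
      congr 1
      refine List.map_congr_left fun p _ => ?_
      simp only [Function.comp, word_cons, pair_ι_mul, pair_twistL]
      ring

end

section

/-! ### Strings for `sl₂` -/

section Strings

variable {k M : Type*} [Field k] [AddCommGroup M] [Module k M] {E F : Module.End k M}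
  {W : ℤ → Submodule k M} {φ : ℤ → k} {a N : ℤ}
  (hE : ∀ j, ∀ m ∈ W j, E m ∈ W (j + 1)) (hF : ∀ j, ∀ m ∈ W j, F m ∈ W (j - 1))
  (hEF : ∀ j, ∀ m ∈ W j, E (F m) - F (E m) = (φ j - φ (j - 1)) • m)
  (hφ : ∀ p j, |a + 2 * p + 1| < a + 2 * j + 1 → φ p ≠ φ j)
  (hN : ∀ j, N ≤ j → W j = ⊥)

include hE hEF hφ hN in
/-- A Casimir eigenvector whose eigenvalue is too small for its weight vanishes. -/
theorem eq_zero_of_casimir_eigenvector (p j : ℤ) (hp : |a + 2 * p + 1| < a + 2 * j + 1) (m : M)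
    (hm : m ∈ W j) (h : F (E m) = (φ p - φ j) • m) : m = 0 := by
  -- `d` bounds the number of steps up to the region where the string vanishes.
  obtain ⟨d, hd⟩ : ∃ d : ℕ, N ≤ j + d := ⟨(N - j).toNat, by omega⟩
  induction d generalizing j m with
  | zero => simpa [hN j (by simpa using hd)] using hm
  | succ d ih =>
    have hEm : E m = 0 := by
      refine ih (j + 1) (by omega) (E m) (hE j m hm) ?_ (by push_cast at hd; omega)
      -- On `W j` the Casimir operator is `F E + φ j`. It commutes with `E`, so `E m` is again an
      -- eigenvector with eigenvalue `φ p`, one step higher.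
      have h1 := hEF (j + 1) (E m) (hE j m hm)
      rw [h, map_smul, add_sub_cancel_right] at h1
      rw [sub_eq_iff_eq_add] at h1
      rw [← sub_eq_iff_eq_add'.2 h1, ← sub_smul]
      congr 1; ring
    -- A vector of `W j` killed by `E` has Casimir eigenvalue `φ j`, which differs from `φ p`.
    rw [hEm, map_zero, eq_comm, smul_eq_zero] at h
    exact h.resolve_left (sub_ne_zero.2 (hφ p j hp))

include hF in
theorem pow_lower_mem (r : ℕ) (j : ℤ) (m : M) (hm : m ∈ W j) : (F ^ r) m ∈ W (j - r) := by
  induction r with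
  | zero => simpa using hm
  | succ r ih =>
    rw [pow_succ', Module.End.mul_apply]
    convert hF _ _ ih using 2
    push_cast; ring

-- The commutator of `E` with `F ^ (r + 1)` is a sum of scalars along the string, which telescopes.
include hF hEF in
theorem pow_lower_casimir (r : ℕ) (j : ℤ) (m : M) (hm : m ∈ W j) :
    (F ^ r) (F (E m)) = E ((F ^ (r + 1)) m) - (φ j - φ (j - r - 1)) • (F ^ r) m := by
  induction r with
  | zero =>
    have := hEF j m hm
    simp only [pow_zero, Module.End.one_apply, zero_add, pow_one, Nat.cast_zero, sub_zero]
    rw [← this]; abel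
  | succ r ih =>
    have h1 := hEF _ _ (pow_lower_mem hF (r + 1) j m hm)
    have h2 : j - ((r + 1 : ℕ) : ℤ) = j - r - 1 := by push_cast; ring
    have h3 : F ((F ^ r) m) = (F ^ (r + 1)) m := by rw [pow_succ', Module.End.mul_apply]
    have h4 : (F ^ (r + 1 + 1)) m = F ((F ^ (r + 1)) m) := by
      rw [pow_succ', Module.End.mul_apply]
    rw [h2] at h1 ⊢
    rw [pow_succ', Module.End.mul_apply, ih, map_sub, map_smul, ← pow_succ', h3, h4,
      ← sub_add_sub_cancel (φ j) (φ (j - r - 1)) (φ (j - r - 1 - 1)), add_smul, ← h1]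
    abel

-- If `F ^ (r + 1)` kills `m`, then `F ^ r` kills the Casimir operator minus `φ (j - r - 1)` applied
-- to `m`. By induction `m` is a Casimir eigenvector with eigenvalue `φ (j - r - 1)`, too small for
-- `W j`.
include hE hF hEF hφ hN in
theorem pow_lower_injective (r : ℕ) : ∀ (j : ℤ) (m : M), m ∈ W j → (r : ℤ) ≤ a + 2 * j →
    (F ^ r) m = 0 → m = 0 := by
  induction r with
  | zero => intro j m _ _ h; simpa using h
  | succ r ih =>
    intro j m hm hr h
    push_cast at hr
    have h1 : F (E m) + (φ j - φ (j - r - 1)) • m = 0 := by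
      refine ih j _ (Submodule.add_mem _ ?_ (Submodule.smul_mem _ _ hm)) (by omega) ?_
      · simpa using hF _ _ (hE j m hm)
      · rw [map_add, map_smul, pow_lower_casimir hF hEF r j m hm, h]
        simp
    refine eq_zero_of_casimir_eigenvector hE hEF hφ hN (j - r - 1) j ?_ m hm ?_
    · rw [abs_lt]; constructor <;> linarith
    · rw [eq_neg_of_add_eq_zero_left h1, ← neg_smul, neg_sub]

end Strings

/-- The difference of the two sides factors, up to a power of `q`, as `(q ^ (A - B) - 1) * (1 - q ^
(-A - B))`. This separates the Casimir eigenvalues. -/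
theorem zpow_add_zpow_neg_ne {k : Type*} [Field k] {q : k} (hq0 : q ≠ 0)
    (hq : ∀ n : ℤ, n ≠ 0 → q ^ n ≠ 1) {A B : ℤ} (h : |A| < B) :
    q ^ A + q ^ (-A) ≠ q ^ B + q ^ (-B) := by
  intro hAB
  rw [abs_lt] at h
  have h1 : (q ^ (A - B) - 1) * (1 - q ^ (-A - B)) = 0 := by
    have e1 : (q ^ (A - B) - 1) * (1 - q ^ (-A - B)) =
        q ^ (-B) * ((q ^ A + q ^ (-A)) - (q ^ B + q ^ (-B))) := by
      simp only [sub_eq_add_neg, zpow_add₀ hq0, mul_add, add_mul, zpow_neg]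
      field_simp
      ring
    rw [e1, hAB, sub_self, mul_zero]
  rcases mul_eq_zero.1 h1 with h2 | h2
  · exact hq (A - B) (by omega) (sub_eq_zero.1 h2)
  · exact hq (-A - B) (by omega) (sub_eq_zero.1 h2).symm

/-! ### Positivity from a finite set of weights stable under reflections -/

/-- The reflections permute the weights, so they act orthogonally on `ℝ^P`, and the orthogonal
complement of the kernel of `ℝ^P → ℝ^I` carries an invariant inner product. If `mu` had nonpositive
value on every coroot in its support, its lift would have nonpositive square norm. -/
theorem exists_pos_of_finite_reflections {I P : Type*} [Fintype I] [DecidableEq I] [Fintype P]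
    (wt : P → I → ℤ) (a : I → I → ℤ) (ha : ∀ i, a i i = 2) (s : I → P → P)
    (hs : ∀ i, Function.Involutive (s i))
    (hwt : ∀ i ρ, wt (s i ρ) = wt ρ - (∑ j, a i j * wt ρ j) • Pi.single i 1)
    (mu : I → ℕ) (hmu : mu ≠ 0)
    (hsupp : ∀ i, mu i ≠ 0 → ∃ ρ ρ', wt ρ' = wt ρ + Pi.single i 1) :
    ∃ i, mu i ≠ 0 ∧ 0 < ∑ j, a i j * (mu j : ℤ) := by
  by_contra! hcon
  classical
  let wtR : P → I → ℝ := fun ρ i => wt ρ i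
  let π : EuclideanSpace ℝ P →ₗ[ℝ] (I → ℝ) := ∑ ρ,
    (LinearMap.toSpanSingleton ℝ (I → ℝ) (wtR ρ)) ∘ₗ
    (EuclideanSpace.proj ρ : EuclideanSpace ℝ P →L[ℝ] ℝ).toLinearMap
  have hπ (x : EuclideanSpace ℝ P) : π x = ∑ ρ, x ρ • wtR ρ := by
    simp only [π, LinearMap.sum_apply, LinearMap.comp_apply, LinearMap.toSpanSingleton_apply]
    rfl
  let n : I → (I → ℝ) →ₗ[ℝ] ℝ := fun i => ∑ j, (a i j : ℝ) • LinearMap.proj j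
  have hn (i : I) (x : I → ℝ) : n i x = ∑ j, (a i j : ℝ) * x j := by simp [n]
  let ε : I → I → ℝ := fun i => Pi.single i 1
  have hnε (i : I) : n i (ε i) = 2 := by
    simp [hn, ε, Pi.single_apply, ha]
  have hwtR (i : I) (ρ : P) : wtR (s i ρ) = wtR ρ - n i (wtR ρ) • ε i := by
    ext k
    have := congrFun (hwt i ρ) k
    simp only [wtR, hn, ε, this, Pi.sub_apply, Pi.smul_apply, Pi.single_apply, smul_eq_mul]
    push_cast
    rfl
  let σ : I → EuclideanSpace ℝ P → EuclideanSpace ℝ P := fun i x => WithLp.toLp 2 fun ρ => x (s i ρ)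
  have hσ (i : I) (x : EuclideanSpace ℝ P) (ρ : P) : σ i x ρ = x (s i ρ) := rfl
  have hπσ (i : I) (x : EuclideanSpace ℝ P) : π (σ i x) = π x - n i (π x) • ε i := by
    rw [hπ, hπ, map_sum, Finset.sum_smul, ← Finset.sum_sub_distrib]
    rw [← Equiv.sum_comp (hs i).toPerm]
    refine Finset.sum_congr rfl fun ρ _ => ?_
    simp only [Function.Involutive.coe_toPerm, hσ, hs i ρ, hwtR, map_smul, smul_sub, smul_smul,
      smul_eq_mul]
  have hadj (i : I) (x y : EuclideanSpace ℝ P) : inner ℝ (σ i x) y = inner ℝ x (σ i y) := by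
    simp only [PiLp.inner_apply]
    rw [← Equiv.sum_comp (hs i).toPerm]
    refine Finset.sum_congr rfl fun ρ _ => ?_
    simp only [Function.Involutive.coe_toPerm, hσ, hs i ρ]
  let K := LinearMap.ker π
  -- `σ i` is self-adjoint and preserves `K`, hence also `Kᗮ`.
  have hσK (i : I) (x : EuclideanSpace ℝ P) (hx : x ∈ Kᗮ) : σ i x ∈ Kᗮ := by
    rw [Submodule.mem_orthogonal] at hx ⊢
    intro y hy
    rw [← hadj]
    refine hx _ ?_
    rw [LinearMap.mem_ker] at hy ⊢
    rw [hπσ, hy]; simp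
  have hinj (x : EuclideanSpace ℝ P) (hx : x ∈ Kᗮ) (h0 : π x = 0) : x = 0 :=
    (Submodule.disjoint_def.1 K.orthogonal_disjoint) x (LinearMap.mem_ker.2 h0) hx
  -- The lift of a simple root is the projection to `Kᗮ` of the difference of two basis vectors
  -- whose weights differ by that root.
  have hex (i : I) : ∃ α : EuclideanSpace ℝ P, mu i ≠ 0 → α ∈ Kᗮ ∧ π α = ε i := by
    by_cases hi : mu i = 0
    · exact ⟨0, fun h => absurd hi h⟩
    obtain ⟨ρ, ρ', hρ⟩ := hsupp i hi
    obtain ⟨y, hy, z, hz, hyz⟩ := K.exists_add_mem_mem_orthogonal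
      (EuclideanSpace.single ρ' (1 : ℝ) - EuclideanSpace.single ρ (1 : ℝ))
    have hπs (ρ : P) : π (EuclideanSpace.single ρ (1 : ℝ)) = wtR ρ := by
      simp [hπ]
    refine ⟨z, fun _ => ⟨hz, ?_⟩⟩
    have h1 := congrArg π hyz
    rw [map_add, LinearMap.mem_ker.1 hy, zero_add, map_sub, hπs, hπs] at h1
    rw [← h1]
    ext k
    simp only [wtR, ε, hρ, Pi.sub_apply, Pi.add_apply, Pi.single_apply]
    push_cast
    ring
  choose α hα using hex
  let u : EuclideanSpace ℝ P := ∑ i, (mu i : ℝ) • α i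
  have hu : u ∈ Kᗮ := by
    refine Submodule.sum_mem _ fun i _ => ?_
    by_cases hi : mu i = 0
    · simp [hi]
    · exact Submodule.smul_mem _ _ (hα i hi).1
  have hπu : π u = fun i => (mu i : ℝ) := by
    have : π u = ∑ i, (mu i : ℝ) • ε i := by
      rw [map_sum]
      refine Finset.sum_congr rfl fun i _ => ?_
      by_cases hi : mu i = 0
      · simp [hi]
      · rw [map_smul, (hα i hi).2]
    rw [this]
    ext k
    simp [ε, Finset.sum_apply, Pi.single_apply]
  -- Both sides lie in `Kᗮ` and have the same image under `π`, which is injective there.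
  have hrefl (i : I) (hi : mu i ≠ 0) (x : EuclideanSpace ℝ P) (hx : x ∈ Kᗮ) :
      σ i x = x - n i (π x) • α i := by
    have h1 := hinj (σ i x - (x - n i (π x) • α i))
      (Submodule.sub_mem _ (hσK i x hx) (Submodule.sub_mem _ hx
        (Submodule.smul_mem _ _ (hα i hi).1))) (by
        rw [map_sub, map_sub, map_smul, (hα i hi).2, hπσ, sub_self])
    exact sub_eq_zero.1 h1
  -- Comparing the two sides of `hadj` gives `2 ⟪α i, u⟫ = n i (π u) * ⟪α i, α i⟫`.
  have hle (i : I) (hi : mu i ≠ 0) : inner ℝ (α i) u ≤ (0 : ℝ) := by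
    have h1 := hadj i (α i) u
    rw [hrefl i hi _ (hα i hi).1, hrefl i hi u hu, (hα i hi).2, hnε, inner_sub_left,
      inner_sub_right, inner_smul_left, inner_smul_right] at h1
    have h2 : n i (π u) ≤ 0 := by
      rw [hπu, hn]
      exact_mod_cast hcon i hi
    have h3 : (0 : ℝ) ≤ inner ℝ (α i) (α i) := real_inner_self_nonneg
    simp only [conj_trivial] at h1
    nlinarith
  have huu : inner ℝ u u ≤ (0 : ℝ) := by
    have : inner ℝ u u = ∑ i, (mu i : ℝ) * inner ℝ (α i) u := by
      nth_rewrite 1 [show u = ∑ i, (mu i : ℝ) • α i from rfl]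
      rw [sum_inner]
      exact Finset.sum_congr rfl fun i _ => by rw [inner_smul_left, conj_trivial]
    rw [this]
    refine Finset.sum_nonpos fun i _ => ?_
    by_cases hi : mu i = 0
    · simp [hi]
    · exact mul_nonpos_of_nonneg_of_nonpos (Nat.cast_nonneg _) (hle i hi)
  have hu0 : u = 0 := inner_self_eq_zero.1 (le_antisymm huu real_inner_self_nonneg)
  apply hmu
  ext i
  have := congrFun hπu i
  rw [hu0, map_zero] at this
  simpa using this.symm

end

section

variable {I : Type u} [Fintype I] [DecidableEq I]

/-! ### Homogeneity of the skew derivations -/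

theorem derL_mem_homog (Ω : I → I → ℤ) (i : I) {mu : I → ℕ} {x : FF I} (hx : x ∈ homog mu) :
    derL Ω i x ∈ homog (fun k => mu k - if k = i then 1 else 0) ∧
      (mu i = 0 → derL Ω i x = 0) := by
  induction hx using Submodule.span_induction with
  | mem x hx =>
    obtain ⟨w, hw, rfl⟩ := hx
    refine ⟨?_, fun h => derL_word_of_notMem Ω i w (List.count_eq_zero.1 ((hw i).trans h))⟩
    convert derL_word_mem Ω i w using 2
    ext k
    rw [List.count_erase, hw]
    by_cases hk : k = i
    · simp [hk]
    · simp [hk, Ne.symm hk]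
  | zero => simp
  | add x y _ _ hx hy =>
    rw [map_add]
    exact ⟨Submodule.add_mem _ hx.1 hy.1, fun h => by rw [hx.2 h, hy.2 h, add_zero]⟩
  | smul c x _ hx =>
    rw [map_smul]
    exact ⟨Submodule.smul_mem _ _ hx.1, fun h => by rw [hx.2 h, smul_zero]⟩

theorem derR_mem_homog (Ω : I → I → ℤ) (i : I) {mu : I → ℕ} {x : FF I} (hx : x ∈ homog mu) :
    derR Ω i x ∈ homog (fun k => mu k - if k = i then 1 else 0) ∧
      (mu i = 0 → derR Ω i x = 0) := by
  induction hx using Submodule.span_induction with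
  | mem x hx =>
    obtain ⟨w, hw, rfl⟩ := hx
    refine ⟨?_, fun h => derR_word_of_notMem Ω i w (List.count_eq_zero.1 ((hw i).trans h))⟩
    convert derR_word_mem Ω i w using 2
    ext k
    rw [List.count_erase, hw]
    by_cases hk : k = i
    · simp [hk]
    · simp [hk, Ne.symm hk]
  | zero => simp
  | add x y _ _ hx hy =>
    rw [map_add]
    exact ⟨Submodule.add_mem _ hx.1 hy.1, fun h => by rw [hx.2 h, hy.2 h, add_zero]⟩
  | smul c x _ hx =>
    rw [map_smul]
    exact ⟨Submodule.smul_mem _ _ hx.1, fun h => by rw [hx.2 h, smul_zero]⟩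

omit [Fintype I] in
theorem eq_algebraMap_aug {x : FF I} (hx : x ∈ homog (0 : I → ℕ)) :
    x = algebraMap 𝕜 _ (aug x) := by
  induction hx using Submodule.span_induction with
  | mem x hx =>
    obtain ⟨w, hw, rfl⟩ := hx
    have : w = [] := List.eq_nil_iff_forall_not_mem.2 fun i hi => by
      have h1 := List.count_pos_iff.2 hi
      rw [hw i] at h1
      exact h1.ne' rfl
    simp [this]
  | zero => simp
  | add x y _ _ hx hy => rw [map_add, map_add, ← hx, ← hy]
  | smul c x _ hx =>
    rw [map_smul, smul_eq_mul, map_mul, ← hx, Algebra.smul_def]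

/-! ### Weight representations -/

/-- A space graded by `ℤ[I]` with operators `E_i`, `F_i`, `K_i`, `K'_i` that satisfy the relations
of `U_{v,t}` other than the Serre relations. -/
structure WeightRep (Ω : I → I → ℤ) (M : Type*) [AddCommGroup M] [Module 𝕜 M] where
  E : I → Module.End 𝕜 M
  F : I → Module.End 𝕜 M
  K : I → Module.End 𝕜 M
  K' : I → Module.End 𝕜 M
  V : (I → ℤ) → Submodule 𝕜 M
  indep : iSupIndep V
  iSup_eq_top : ⨆ lam, V lam = ⊤
  E_mem : ∀ i lam, ∀ m ∈ V lam, E i m ∈ V (lam + e i)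
  F_mem : ∀ i lam, ∀ m ∈ V lam, F i m ∈ V (lam - e i)
  K_apply : ∀ i lam, ∀ m ∈ V lam, K i m = brace Ω (e i) lam • m
  K'_apply : ∀ i lam, ∀ m ∈ V lam, K' i m = (brace Ω lam (e i))⁻¹ • m
  comm_same : ∀ i, E i * F i - F i * E i = (vi Ω i - (vi Ω i)⁻¹)⁻¹ • (K i - K' i)
  comm_ne : ∀ i j, i ≠ j → E i * F j - F j * E i = 0

namespace WeightRep

variable {Ω : I → I → ℤ} {M : Type*} [AddCommGroup M] [Module 𝕜 M] (R : WeightRep Ω M)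

/-- The representation of the transposed datum obtained by exchanging `E` with `F` and `K` with
`K'` and negating the weights. -/
def swap : WeightRep (transp Ω) M where
  E := R.F
  F := R.E
  K := R.K'
  K' := R.K
  V lam := R.V (-lam)
  indep := R.indep.comp neg_injective
  iSup_eq_top := by
    rw [← R.iSup_eq_top]
    exact (Equiv.neg (I → ℤ)).iSup_comp
  E_mem i lam m hm := by
    have := R.F_mem i _ m hm
    rwa [neg_add']
  F_mem i lam m hm := by
    have := R.E_mem i _ m hm
    rwa [neg_sub', sub_neg_eq_add]
  K_apply i lam m hm := by
    rw [R.K'_apply i _ m hm, brace_transp, brace_neg_left, inv_inv]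
  K'_apply i lam m hm := by
    rw [R.K_apply i _ m hm, brace_transp, brace_neg_right]
  comm_same i := by
    rw [vi_transp, ← neg_sub (R.K i), smul_neg, ← R.comm_same, neg_sub]
  comm_ne i j h := by
    rw [← neg_sub, R.comm_ne j i h.symm, neg_zero]

/-- The action of `'f` through the `E_i`. -/
def plus : FF I →ₐ[𝕜] Module.End 𝕜 M := FreeAlgebra.lift 𝕜 R.E

/-- The action of `'f` through the `F_i`. -/
def minus : FF I →ₐ[𝕜] Module.End 𝕜 M := FreeAlgebra.lift 𝕜 R.F

@[simp] theorem plus_ι (i : I) : R.plus (FreeAlgebra.ι 𝕜 i) = R.E i := by simp [plus]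

@[simp] theorem minus_ι (i : I) : R.minus (FreeAlgebra.ι 𝕜 i) = R.F i := by simp [minus]

theorem linearMap_ext {N : Type*} [AddCommGroup N] [Module 𝕜 N] {f g : M →ₗ[𝕜] N}
    (h : ∀ lam, ∀ m ∈ R.V lam, f m = g m) : f = g := by
  have : (⊤ : Submodule 𝕜 M) ≤ LinearMap.eqLocus f g := by
    rw [← R.iSup_eq_top]
    exact iSup_le fun lam m hm => h lam m hm
  ext m
  exact this trivial

theorem K_mul_E (i j : I) : R.K i * R.E j = brace Ω (e i) (e j) • (R.E j * R.K i) := by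
  refine R.linearMap_ext fun lam m hm => ?_
  simp only [Module.End.mul_apply, LinearMap.smul_apply, R.K_apply i _ _ hm, map_smul,
    R.K_apply i _ _ (R.E_mem j _ _ hm), brace_add_right, smul_smul, mul_comm]

theorem E_mul_K' (i j : I) : R.E j * R.K' i = brace Ω (e j) (e i) • (R.K' i * R.E j) := by
  refine R.linearMap_ext fun lam m hm => ?_
  simp only [Module.End.mul_apply, LinearMap.smul_apply, R.K'_apply i _ _ hm, map_smul,
    R.K'_apply i _ _ (R.E_mem j _ _ hm), brace_add_left, smul_smul]
  congr 1
  have := brace_ne_zero Ω (e j) (e i)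
  have := brace_ne_zero Ω lam (e i)
  field_simp

theorem K_mul_plus (i : I) (x : FF I) : R.K i * R.plus x = R.plus (twistR Ω i x) * R.K i := by
  induction x using FreeAlgebra.induction with
  | grade0 r => simp [Algebra.commutes]
  | grade1 j => simp [K_mul_E]
  | add x y hx hy => simp only [map_add, mul_add, add_mul, hx, hy]
  | mul x y hx hy => rw [map_mul, map_mul, map_mul, ← mul_assoc, hx, mul_assoc, hy, mul_assoc]

/-- The commutator of `x⁺` and `F_i`. -/
theorem plus_mul_F_sub (i : I) (x : FF I) : R.plus x * R.F i - R.F i * R.plus x =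
    (vi Ω i - (vi Ω i)⁻¹)⁻¹ •
      (R.plus (derR Ω i x) * R.K i - R.K' i * R.plus (derL Ω i x)) := by
  suffices h : LinearMap.mulRight 𝕜 (R.F i) ∘ₗ R.plus.toLinearMap -
      LinearMap.mulLeft 𝕜 (R.F i) ∘ₗ R.plus.toLinearMap =
      (vi Ω i - (vi Ω i)⁻¹)⁻¹ •
        (LinearMap.mulRight 𝕜 (R.K i) ∘ₗ R.plus.toLinearMap ∘ₗ derR Ω i -
          LinearMap.mulLeft 𝕜 (R.K' i) ∘ₗ R.plus.toLinearMap ∘ₗ derL Ω i) from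
    LinearMap.congr_fun h x
  refine linearMap_ext_word fun w => ?_
  simp only [LinearMap.sub_apply, LinearMap.comp_apply, LinearMap.smul_apply,
    LinearMap.mulRight_apply, LinearMap.mulLeft_apply, AlgHom.toLinearMap_apply]
  induction w with
  | nil => simp
  | cons j w ih =>
    have h1 : R.plus (word (j :: w)) * R.F i - R.F i * R.plus (word (j :: w)) =
        R.E j * (R.plus (word w) * R.F i - R.F i * R.plus (word w)) +
          (R.E j * R.F i - R.F i * R.E j) * R.plus (word w) := by
      rw [word_cons, map_mul, plus_ι]; noncomm_ring
    rw [h1, ih, word_cons, derR_ι_mul, derL_ι_mul]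
    by_cases hj : j = i
    · subst hj
      rw [R.comm_same]
      simp only [if_true, map_add, map_mul, map_smul, plus_ι, mul_add, add_mul, mul_sub, sub_mul,
        smul_sub, smul_add, mul_smul_comm, smul_mul_assoc, ← mul_assoc, E_mul_K', K_mul_plus]
      abel
    · rw [R.comm_ne j i hj]
      simp only [if_neg hj, map_mul, map_smul, plus_ι, mul_sub, smul_sub, mul_smul_comm,
        smul_mul_assoc, ← mul_assoc, E_mul_K', zero_mul, add_zero]

theorem plus_word_mem (w : List I) (lam : I → ℤ) (m : M) (hm : m ∈ R.V lam) :
    R.plus (word w) m ∈ R.V (lam + wdeg w) := by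
  induction w with
  | nil => simpa using hm
  | cons i w ih =>
    rw [word_cons, map_mul, plus_ι, wdeg_cons, ← add_assoc]
    exact R.E_mem i _ _ ih

theorem plus_mem {mu : I → ℕ} {x : FF I} (hx : x ∈ homog mu) (lam : I → ℤ) (m : M)
    (hm : m ∈ R.V lam) : R.plus x m ∈ R.V (lam + fun i => (mu i : ℤ)) := by
  induction hx using Submodule.span_induction with
  | mem x hx =>
    obtain ⟨w, hw, rfl⟩ := hx
    have hd : wdeg w = fun i => (mu i : ℤ) := funext fun i => by rw [wdeg, hw]
    rw [← hd]
    exact R.plus_word_mem w lam m hm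
  | zero => simp
  | add x y _ _ hx hy => rw [map_add]; exact Submodule.add_mem _ hx hy
  | smul c x _ hx => rw [map_smul]; exact Submodule.smul_mem _ _ hx

theorem minus_mem {mu : I → ℕ} {x : FF I} (hx : x ∈ homog mu) (lam : I → ℤ) (m : M)
    (hm : m ∈ R.V lam) : R.minus x m ∈ R.V (lam - fun i => (mu i : ℤ)) := by
  have := R.swap.plus_mem hx (-lam) m (by simpa [swap] using hm)
  rw [show lam - (fun i => (mu i : ℤ)) = -(-lam + fun i => (mu i : ℤ)) by abel]
  exact this

/-! #### The root strings -/

theorem finite_weights [FiniteDimensional 𝕜 M] : {lam | R.V lam ≠ ⊥}.Finite :=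
  WellFoundedGT.finite_ne_bot_of_iSupIndep R.indep

end WeightRep

/-! ### Coroots -/

/-- The Cartan integers. -/
def cartan (Ω : I → I → ℤ) (i j : I) : ℤ := (Ω i j + Ω j i) / Ω i i

/-- The value of the coroot of `i` on a weight. -/
def coroot (Ω : I → I → ℤ) (i : I) (lam : I → ℤ) : ℤ := ∑ j, cartan Ω i j * lam j

section Coroot

variable {Ω : I → I → ℤ}

omit [DecidableEq I] in
theorem coroot_add (i : I) (a b : I → ℤ) : coroot Ω i (a + b) = coroot Ω i a + coroot Ω i b := by
  simp [coroot, mul_add, Finset.sum_add_distrib]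

omit [DecidableEq I] in
theorem coroot_smul (i : I) (n : ℤ) (a : I → ℤ) : coroot Ω i (n • a) = n * coroot Ω i a := by
  simp [coroot, Finset.mul_sum, mul_left_comm]

omit [DecidableEq I] in
theorem coroot_neg (i : I) (a : I → ℤ) : coroot Ω i (-a) = -coroot Ω i a := by
  simp [coroot]

omit [DecidableEq I] in
theorem coroot_transp (i : I) (a : I → ℤ) : coroot (transp Ω) i a = coroot Ω i a := by
  simp [coroot, cartan, transp, add_comm]

variable (hΩ : IsCartan Ω)
include hΩ

omit [DecidableEq I] in
theorem cartan_self (i : I) : cartan Ω i i = 2 := by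
  rw [cartan, ← two_mul, Int.mul_ediv_cancel _ (hΩ.diag_pos i).ne']

theorem coroot_e (i : I) : coroot Ω i (e i) = 2 := by
  simp [coroot, e, Pi.single_apply, cartan_self hΩ]

theorem diag_mul_coroot (i : I) (lam : I → ℤ) : Ω i i * coroot Ω i lam = dot Ω (e i) lam := by
  have h1 (j : I) : Ω i i * cartan Ω i j = Ω i j + Ω j i := by
    by_cases hij : i = j
    · subst hij; rw [cartan_self hΩ]; ring
    · exact Int.mul_ediv_cancel' (hΩ.dvd i j hij)
  simp only [coroot, dot, ang, e, Finset.mul_sum, ← mul_assoc, h1]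
  simp [Pi.single_apply, mul_add, Finset.sum_add_distrib, mul_comm]

theorem vi_zpow_coroot (i : I) (lam : I → ℤ) : vi Ω i ^ coroot Ω i lam = v ^ dot Ω (e i) lam := by
  rw [vi, ← zpow_mul, diag_mul_coroot hΩ]

end Coroot

/-! ### Root strings and reflections in finite-dimensional representations -/

namespace WeightRep

variable {Ω : I → I → ℤ} {M : Type*} [AddCommGroup M] [Module 𝕜 M] (R : WeightRep Ω M)

theorem exists_string_bound [FiniteDimensional 𝕜 M] (i : I) (lam : I → ℤ) :
    ∃ N : ℤ, ∀ j, N ≤ j → R.V (lam + j • e i) = ⊥ := by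
  have hinj : Function.Injective fun j : ℤ => lam + j • e i := by
    intro a b h
    simpa [e] using congrFun h i
  obtain ⟨N, hN⟩ := (R.finite_weights.preimage hinj.injOn).bddAbove
  refine ⟨N + 1, fun j hj => ?_⟩
  by_contra h
  have := hN (show j ∈ _ from h)
  omega

variable (hΩ : IsCartan Ω) [FiniteDimensional 𝕜 M]
include hΩ

/-- The `i`-string through `lam` is an instance of the abstract strings; its Casimir values are
separated because `v_i` is not a root of unity. -/
theorem pow_F_injective (i : I) (lam : I → ℤ) (r : ℕ) (hr : (r : ℤ) ≤ coroot Ω i lam) (m : M)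
    (hm : m ∈ R.V lam) (h : (R.F i ^ r) m = 0) : m = 0 := by
  obtain ⟨N, hN⟩ := R.exists_string_bound i lam
  set q := vi Ω i with hq
  have hq0 : q ≠ 0 := zpow_ne_zero _ v_ne_zero
  have hqq : q - q⁻¹ ≠ 0 := vi_sub_inv_ne_zero hΩ i
  set a := coroot Ω i lam with ha
  set c := t ^ (ang Ω lam (e i) - ang Ω (e i) lam) with hc
  have hc0 : c ≠ 0 := zpow_ne_zero _ t_ne_zero
  -- Normalised so that `φ j - φ (j - 1)` is the scalar by which `(K_i - K'_i) / (v_i - v_i⁻¹)` acts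
  -- on the `j`-th weight space of the string.
  let φ : ℤ → 𝕜 := fun j =>
    (q - q⁻¹)⁻¹ * ((q - q⁻¹)⁻¹ * c) * (q ^ (a + 2 * j + 1) + q ^ (-(a + 2 * j + 1)))
  -- The exponent of `t` is antisymmetric, so adding multiples of `e i` leaves `c` unchanged; only
  -- the power of `q` moves, by two per step.
  have hbr (j : ℤ) : brace Ω (e i) (lam + j • e i) = c * q ^ (a + 2 * j) ∧
      brace Ω (lam + j • e i) (e i) = c⁻¹ * q ^ (a + 2 * j) := by
    have h1 : coroot Ω i (lam + j • e i) = a + 2 * j := by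
      rw [coroot_add, coroot_smul, coroot_e hΩ, mul_comm]
    have h2 := vi_zpow_coroot hΩ i (lam + j • e i)
    have h3 : dot Ω (lam + j • e i) (e i) = dot Ω (e i) (lam + j • e i) := by
      simp only [dot]; ring
    have h4 (a b : I → ℤ) (n : ℤ) : ang Ω a (n • b) = n * ang Ω a b := by
      simp only [ang, Pi.smul_apply, smul_eq_mul, Finset.mul_sum]
      exact Finset.sum_congr rfl fun _ _ => Finset.sum_congr rfl fun _ _ => by ring
    have h5 (a b : I → ℤ) (n : ℤ) : ang Ω (n • a) b = n * ang Ω a b := by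
      simp only [ang, Pi.smul_apply, smul_eq_mul, Finset.mul_sum]
      exact Finset.sum_congr rfl fun _ _ => Finset.sum_congr rfl fun _ _ => by ring
    rw [h1, ← hq] at h2
    rw [brace, brace, h3, ← h2, mul_comm, mul_comm (q ^ _), hc, ← zpow_neg]
    simp only [ang_add_left, ang_add_right, h4, h5]
    constructor <;> congr 2 <;> ring
  refine pow_lower_injective (E := R.E i) (F := R.F i) (W := fun j => R.V (lam + j • e i))
    (φ := φ) (a := a) (N := N) ?_ ?_ ?_ ?_ hN r 0 m (by simpa using hm) (by simpa using hr) h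
  · intro j m hm
    have := R.E_mem i _ m hm
    rwa [add_assoc, ← add_one_zsmul] at this
  · intro j m hm
    have := R.F_mem i _ m hm
    rwa [add_sub_assoc, sub_eq_add_neg, ← sub_one_zsmul] at this
  · intro j m hm
    have h1 := LinearMap.congr_fun (R.comm_same i) m
    simp only [LinearMap.sub_apply, Module.End.mul_apply, LinearMap.smul_apply,
      R.K_apply i _ m hm, R.K'_apply i _ m hm, hbr] at h1
    rw [h1, ← sub_smul, smul_smul]
    congr 1
    simp only [φ]
    rw [show a + 2 * (j - 1) + 1 = a + 2 * j - 1 by ring, neg_add', neg_sub, sub_eq_neg_add 1,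
      zpow_add_one₀ hq0, zpow_sub_one₀ hq0, zpow_sub_one₀ hq0, zpow_add_one₀ hq0, zpow_neg,
      mul_inv, inv_inv, ← hq]
    have hd := inv_mul_cancel₀ hqq
    generalize (q - q⁻¹)⁻¹ = d at hd
    linear_combination
      -(d * c * (q ^ (a + 2 * j) - (q ^ (a + 2 * j))⁻¹)) * hd
  · intro p j hpj hφ
    refine zpow_add_zpow_neg_ne hq0 (fun n hn => vi_zpow_ne_one hΩ i hn) hpj ?_
    exact mul_left_cancel₀ (mul_ne_zero (inv_ne_zero hqq) (mul_ne_zero (inv_ne_zero hqq) hc0)) hφ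

theorem pow_E_injective (i : I) (lam : I → ℤ) (r : ℕ) (hr : (r : ℤ) ≤ -coroot Ω i lam) (m : M)
    (hm : m ∈ R.V lam) (h : (R.E i ^ r) m = 0) : m = 0 := by
  refine R.swap.pow_F_injective hΩ.transp i (-lam) r ?_ m (by simpa [swap] using hm) h
  rwa [coroot_transp, coroot_neg]

omit hΩ [FiniteDimensional 𝕜 M] in
theorem pow_F_mem (i : I) (r : ℕ) (lam : I → ℤ) (m : M) (hm : m ∈ R.V lam) :
    (R.F i ^ r) m ∈ R.V (lam - (r : ℤ) • e i) := by
  induction r with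
  | zero => simpa using hm
  | succ r ih =>
    rw [pow_succ', Module.End.mul_apply, Nat.cast_succ, add_one_zsmul, ← sub_sub]
    exact R.F_mem i _ _ ih

omit hΩ [FiniteDimensional 𝕜 M] in
theorem pow_E_mem (i : I) (r : ℕ) (lam : I → ℤ) (m : M) (hm : m ∈ R.V lam) :
    (R.E i ^ r) m ∈ R.V (lam + (r : ℤ) • e i) := by
  induction r with
  | zero => simpa using hm
  | succ r ih =>
    rw [pow_succ', Module.End.mul_apply, Nat.cast_succ, add_one_zsmul, ← add_assoc]
    exact R.E_mem i _ _ ih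

/-- `F_i ^ n` and `E_i ^ n` are injective between a weight space and its reflection, so their
composite is an injective endomorphism of a finite-dimensional space, hence surjective. -/
theorem exists_pow_F_eq (i : I) (lam : I → ℤ) (n : ℕ) (hn : coroot Ω i lam = n) (m : M)
    (hm : m ∈ R.V (lam - (n : ℤ) • e i)) : ∃ m' ∈ R.V lam, (R.F i ^ n) m' = m := by
  let A : R.V lam →ₗ[𝕜] R.V (lam - (n : ℤ) • e i) :=
    (R.F i ^ n).restrict fun m hm => R.pow_F_mem i n lam m hm
  let B : R.V (lam - (n : ℤ) • e i) →ₗ[𝕜] R.V lam :=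
    (R.E i ^ n).restrict fun m hm => by simpa using R.pow_E_mem i n _ m hm
  have hA : Function.Injective A := (injective_iff_map_eq_zero A).2 fun x hx =>
    Subtype.ext (R.pow_F_injective hΩ i lam n hn.ge x x.2 (congrArg Subtype.val hx))
  have hB : Function.Injective B := (injective_iff_map_eq_zero B).2 fun x hx =>
    Subtype.ext (R.pow_E_injective hΩ i _ n (by
      rw [sub_eq_add_neg, coroot_add, coroot_neg, coroot_smul, coroot_e hΩ, hn]
      apply le_of_eq; ring) x x.2 (congrArg Subtype.val hx))
  have hAB : Function.Surjective (A ∘ₗ B) :=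
    LinearMap.injective_iff_surjective.1 (hA.comp hB)
  obtain ⟨x, hx⟩ := hAB ⟨m, hm⟩
  exact ⟨B x, (B x).2, congrArg Subtype.val hx⟩

/-- A power of `F_i` or of `E_i`, according to the sign of the coroot value, maps the weight space
injectively to the reflected one. -/
theorem reflection_ne_bot (i : I) (lam : I → ℤ) (h : R.V lam ≠ ⊥) :
    R.V (lam - coroot Ω i lam • e i) ≠ ⊥ := by
  obtain ⟨m, hm, hm0⟩ := Submodule.exists_mem_ne_zero_of_ne_bot h
  rcases le_total 0 (coroot Ω i lam) with hn | hn
  · obtain ⟨n, hn⟩ := Int.eq_ofNat_of_zero_le hn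
    rw [hn]
    exact (Submodule.ne_bot_iff _).2 ⟨_, R.pow_F_mem i n lam m hm,
      fun h => hm0 (R.pow_F_injective hΩ i lam n hn.ge m hm h)⟩
  · obtain ⟨n, hn⟩ := Int.exists_eq_neg_ofNat hn
    rw [hn, neg_smul, sub_neg_eq_add]
    exact (Submodule.ne_bot_iff _).2 ⟨_, R.pow_E_mem i n lam m hm,
      fun h => hm0 (R.pow_E_injective hΩ i lam n (by rw [hn, neg_neg]) m hm h)⟩

/-- An operator that commutes with `F_i` and raises the `i`-weight vanishes. -/
theorem eq_zero_of_commute_F (i : I) (nu : I → ℤ) (hnu : 0 < coroot Ω i nu) (f : Module.End 𝕜 M)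
    (hf : ∀ lam, ∀ m ∈ R.V lam, f m ∈ R.V (lam + nu)) (hcomm : Commute f (R.F i)) : f = 0 := by
  have hpow (n : ℕ) (m : M) : f ((R.F i ^ n) m) = (R.F i ^ n) (f m) :=
    LinearMap.congr_fun (hcomm.pow_right n).eq m
  -- Descending along the string: `k` bounds the distance from `lam` to the place above which all
  -- weight spaces vanish.
  have key (k : ℕ) : ∀ lam, 0 ≤ coroot Ω i lam →
      (∀ j : ℤ, k ≤ j → R.V (lam + j • e i) = ⊥) → ∀ m ∈ R.V lam, f m = 0 := by
    induction k with
    | zero =>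
      intro lam _ hk m hm
      have := hk 0 le_rfl
      rw [zero_smul, add_zero] at this
      rw [this, Submodule.mem_bot] at hm
      rw [hm, map_zero]
    | succ k ih =>
      intro lam hlam hk m hm
      obtain ⟨n, hn⟩ := Int.eq_ofNat_of_zero_le hlam
      have hn' : coroot Ω i (lam + e i) = (n + 2 : ℕ) := by
        rw [coroot_add, coroot_e hΩ, hn]; push_cast; ring
      -- The vector `F_i ^ (n + 1) m` has the weight obtained by reflecting `lam + e i`, whose
      -- coroot value is `n + 2`. Hence it equals `F_i ^ (n + 2) m'` with `m'` one step higher,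
      -- where `f` is already known to vanish.
      obtain ⟨m', hm', h⟩ := R.exists_pow_F_eq hΩ i (lam + e i) (n + 2) hn' ((R.F i ^ (n + 1)) m)
        (by
          convert R.pow_F_mem i (n + 1) lam m hm using 2
          push_cast
          simp only [add_smul, one_smul, two_smul]
          abel)
      have h1 : f m' = 0 := by
        refine ih (lam + e i) (by omega) (fun j hj => ?_) m' hm'
        have := hk (j + 1) (by push_cast; omega)
        rwa [add_one_zsmul, add_comm _ (e i), ← add_assoc] at this
      -- Positivity of `coroot Ω i nu` supplies the extra step: the coroot value of `lam + nu` is at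
      -- least `n + 1`.
      refine R.pow_F_injective hΩ i (lam + nu) (n + 1) ?_ (f m) (hf lam m hm) ?_
      · rw [coroot_add, hn]; push_cast; omega
      · rw [← hpow, ← h, hpow, h1, map_zero]
  have key' (lam : I → ℤ) (h : 0 ≤ coroot Ω i lam) (m : M) (hm : m ∈ R.V lam) : f m = 0 := by
    obtain ⟨N, hN⟩ := R.exists_string_bound i lam
    exact key N.toNat lam h (fun j hj => hN j (by omega)) m hm
  refine R.linearMap_ext fun lam m hm => ?_
  rw [LinearMap.zero_apply]
  rcases le_total 0 (coroot Ω i lam) with h | h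
  · exact key' lam h m hm
  -- A vector of negative `i`-weight is `F_i ^ n` of a vector in the reflected weight space, and `f`
  -- commutes with `F_i ^ n`.
  · obtain ⟨n, hn⟩ := Int.exists_eq_neg_ofNat h
    have hn' : coroot Ω i (lam + (n : ℤ) • e i) = n := by
      rw [coroot_add, coroot_smul, coroot_e hΩ, hn]; ring
    obtain ⟨m', hm', rfl⟩ := R.exists_pow_F_eq hΩ i _ n hn' m (by simpa using hm)
    rw [hpow, key' _ (by omega) m' hm', map_zero]

/-- Nonvanishing of `E_i` provides two weights that differ by `e i`, so every simple root in the
support of `mu` is a difference of weights. -/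
theorem exists_coroot_pos (mu : I → ℕ) (hmu : mu ≠ 0) (hE : ∀ i, mu i ≠ 0 → R.E i ≠ 0) :
    ∃ i, mu i ≠ 0 ∧ 0 < coroot Ω i (fun i => (mu i : ℤ)) := by
  have : Finite {lam // R.V lam ≠ ⊥} := R.finite_weights.to_subtype
  have := Fintype.ofFinite {lam // R.V lam ≠ ⊥}
  refine exists_pos_of_finite_reflections (P := {lam // R.V lam ≠ ⊥}) (fun ρ => ρ.1) (cartan Ω)
    (cartan_self hΩ) (fun i ρ => ⟨_, R.reflection_ne_bot hΩ i ρ.1 ρ.2⟩) ?_ ?_ mu hmu ?_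
  · intro i ρ
    apply Subtype.ext
    simp only [sub_eq_add_neg, coroot_add, coroot_smul, coroot_e hΩ, ← neg_smul,
      add_assoc, ← add_smul]
    ring_nf
  · intro i ρ
    rfl
  · intro i hi
    have h := hE i hi
    contrapose! h
    refine R.linearMap_ext fun lam m hm => ?_
    by_contra hne
    rw [LinearMap.zero_apply] at hne
    have h1 : R.V lam ≠ ⊥ :=
      (Submodule.ne_bot_iff _).2 ⟨m, hm, fun h0 => hne (by rw [h0, map_zero])⟩
    have h2 : R.V (lam + e i) ≠ ⊥ := (Submodule.ne_bot_iff _).2 ⟨_, R.E_mem i lam m hm, hne⟩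
    exact h ⟨lam, h1⟩ ⟨_, h2⟩ rfl

/-! ### The radicals of the pairing act by zero -/

omit hΩ [FiniteDimensional 𝕜 M] in
theorem plus_eq_zero_of_E_eq_zero (i : I) (hi : R.E i = 0) {mu : I → ℕ} (hmu : mu i ≠ 0) {x : FF I}
    (hx : x ∈ homog mu) : R.plus x = 0 := by
  induction hx using Submodule.span_induction with
  | mem x hx =>
    obtain ⟨w, hw, rfl⟩ := hx
    have hiw : i ∈ w := List.count_pos_iff.1 (by rw [hw]; omega)
    obtain ⟨a, b, rfl⟩ := List.append_of_mem hiw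
    simp [word_append, word_cons, hi]
  | zero => simp
  | add x y _ _ hx hy => rw [map_add, hx, hy, add_zero]
  | smul c x _ hx => rw [map_smul, hx, smul_zero]

/-- The left radical of the pairing acts by zero. -/
theorem plus_eq_zero_of_pair_eq_zero {mu : I → ℕ} {x : FF I} (hx : x ∈ homog mu)
    (h : ∀ y, pair Ω x y = 0) : R.plus x = 0 := by
  obtain ⟨n, hn⟩ : ∃ n, n = ∑ i, mu i := ⟨_, rfl⟩
  induction n generalizing mu x with
  | zero =>
    have h0 : mu = 0 := by
      ext i
      exact Finset.sum_eq_zero_iff.1 hn.symm i (Finset.mem_univ i)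
    subst h0
    rw [eq_algebraMap_aug hx, ← pair_one Ω, h 1]
    simp
  | succ n ih =>
    have hmu : mu ≠ 0 := by
      rintro rfl
      simp at hn
    -- Positivity is available only if every letter of `mu` acts nontrivially; otherwise each word
    -- of degree `mu` contains a letter that acts by zero.
    by_cases hE : ∀ i, mu i ≠ 0 → R.E i ≠ 0
    · obtain ⟨i, hi, hpos⟩ := R.exists_coroot_pos hΩ mu hmu hE
      refine R.eq_zero_of_commute_F hΩ i _ hpos _ (fun lam m hm => R.plus_mem hx lam m hm) ?_
      have hc : pairC Ω i ≠ 0 := by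
        rw [pairC, ← neg_sub]
        exact inv_ne_zero (neg_ne_zero.2 (vi_sub_inv_ne_zero hΩ i))
      -- The truncated subtraction lowers the height by exactly one because `mu i ≠ 0`.
      have hsum : n = ∑ k, (mu k - if k = i then 1 else 0) := by
        have h1 : ∑ k, mu k = ∑ k, (mu k - if k = i then 1 else 0) +
            ∑ k, (if k = i then 1 else 0) := by
          rw [← Finset.sum_add_distrib]
          refine Finset.sum_congr rfl fun k _ => ?_
          split_ifs with hk
          · subst hk; omega
          · simp
        simp only [Finset.sum_ite_eq', Finset.mem_univ, if_true] at h1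
        omega
      -- The derivative stays in the radical, being adjoint to multiplication by `θ_i`.
      have hL : R.plus (derL Ω i x) = 0 := by
        refine ih (derL_mem_homog Ω i hx).1 (fun y => ?_) hsum
        have := pair_ι_mul Ω i x y
        rw [h] at this
        exact (mul_eq_zero.1 this.symm).resolve_left hc
      have hR : R.plus (derR Ω i x) = 0 := by
        refine ih (derR_mem_homog Ω i hx).1 (fun y => ?_) hsum
        have := pair_mul_ι Ω i x y
        rw [h] at this
        exact (mul_eq_zero.1 this.symm).resolve_left hc
      have := R.plus_mul_F_sub i x
      rw [hL, hR, zero_mul, mul_zero, sub_zero, smul_zero] at this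
      exact sub_eq_zero.1 this
    · push Not at hE
      obtain ⟨i, hi, hEi⟩ := hE
      exact R.plus_eq_zero_of_E_eq_zero i hEi hi hx

/-- The right radical of the pairing acts by zero. -/
theorem minus_eq_zero_of_pair_eq_zero {mu : I → ℕ} {y : FF I} (hy : y ∈ homog mu)
    (h : ∀ x, pair Ω x y = 0) : R.minus y = 0 :=
  R.swap.plus_eq_zero_of_pair_eq_zero hΩ.transp hy fun x => by rw [pair_transp, h]

end WeightRep

end

section

variable {I : Type u} [Fintype I] [DecidableEq I]

/-! ### Dual families and the quasi-R-matrix -/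

/-- A finite family of pairs of homogeneous elements of `'f`. -/
structure HomogFamily (I : Type u) [DecidableEq I] where
  κ : Type u
  [fintype : Fintype κ]
  deg : κ → I → ℕ
  b : κ → FF I
  bs : κ → FF I
  b_mem : ∀ k, b k ∈ homog (deg k)
  bs_mem : ∀ k, bs k ∈ homog (deg k)

attribute [instance] HomogFamily.fintype

/-- The degree of a member of a family, as a weight. -/
def HomogFamily.wt {I : Type u} [DecidableEq I] (B : HomogFamily I) (k : B.κ) : I → ℤ :=
  fun i => (B.deg k i : ℤ)

namespace WeightRep

variable {Ω : I → I → ℤ} {M : Type*} [AddCommGroup M] [Module 𝕜 M] (R : WeightRep Ω M)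
  {M' : Type*} [AddCommGroup M'] [Module 𝕜 M'] (R' : WeightRep Ω M')

/-- On `M`, every element of `'f` can be expanded in the family by means of the pairing. -/
structure Reproduces (B : HomogFamily I) : Prop where
  plus : ∀ x, R.plus x = ∑ k, pair Ω x (B.b k) • R.plus (B.bs k)
  minus : ∀ y, R.minus y = ∑ k, pair Ω (B.bs k) y • R.minus (B.b k)

/-- `Θ = ∑ b ⊗ b*` on `M ⊗ M'`. -/
def theta (B : HomogFamily I) : Module.End 𝕜 (M ⊗[𝕜] M') :=
  ∑ k, TensorProduct.map (R.minus (B.b k)) (R'.plus (B.bs k))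

/-- The action of `'f` on `M ⊗ M'` through `Δ(F_i) = 1 ⊗ F_i + F_i ⊗ K'_i`. -/
def coprod : FF I →ₐ[𝕜] Module.End 𝕜 (M ⊗[𝕜] M') :=
  FreeAlgebra.lift 𝕜 fun i =>
    TensorProduct.map 1 (R'.F i) + TensorProduct.map (R.F i) (R'.K' i)

/-- The action of `'f` on `M ⊗ M'` through `Δᵒᵖ(F_i) = F_i ⊗ 1 + K'_i ⊗ F_i`. -/
def coprodOp : FF I →ₐ[𝕜] Module.End 𝕜 (M ⊗[𝕜] M') :=
  FreeAlgebra.lift 𝕜 fun i =>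
    TensorProduct.map (R.F i) 1 + TensorProduct.map (R.K' i) (R'.F i)

theorem tensor_ext {N : Type*} [AddCommGroup N] [Module 𝕜 N] {f g : M ⊗[𝕜] M' →ₗ[𝕜] N}
    (h : ∀ lam mu, ∀ m ∈ R.V lam, ∀ m' ∈ R'.V mu, f (m ⊗ₜ m') = g (m ⊗ₜ m')) : f = g := by
  refine TensorProduct.ext (R.linearMap_ext fun lam m hm => R'.linearMap_ext fun mu m' hm' => ?_)
  exact h lam mu m hm m' hm'

variable {R R'} {B : HomogFamily I}

/-- Expanding the changed factor on either side gives the same double sum, with coefficients `(φ b*,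
b) = (b*, ψ b)`. An operation on one leg of `Θ` can thus be traded for its adjoint on the other. -/
theorem sum_map_adjoint (hR : R.Reproduces B) (hR' : R'.Reproduces B) (φ ψ : FF I → FF I)
    (h : ∀ x y, pair Ω (φ x) y = pair Ω x (ψ y)) :
    ∑ k, TensorProduct.map (R.minus (B.b k)) (R'.plus (φ (B.bs k))) =
      ∑ k, TensorProduct.map (R.minus (ψ (B.b k))) (R'.plus (B.bs k)) := by
  have h1 (k : B.κ) : TensorProduct.map (R.minus (B.b k)) (R'.plus (φ (B.bs k))) =
      ∑ j, pair Ω (B.bs k) (ψ (B.b j)) •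
        TensorProduct.map (R.minus (B.b k)) (R'.plus (B.bs j)) := by
    rw [hR'.plus (φ (B.bs k)), ← TensorProduct.mapBilinear_apply, map_sum]
    simp [h]
  have h2 (j : B.κ) : TensorProduct.map (R.minus (ψ (B.b j))) (R'.plus (B.bs j)) =
      ∑ k, pair Ω (B.bs k) (ψ (B.b j)) •
        TensorProduct.map (R.minus (B.b k)) (R'.plus (B.bs j)) := by
    rw [hR.minus (ψ (B.b j)), ← TensorProduct.mapBilinear_apply, map_sum]
    simp [LinearMap.sum_apply]
  simp_rw [h1, h2]
  exact Finset.sum_comm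

/-- The commutation of `Θ` with `F_i`. -/
theorem theta_comm_F (hR : R.Reproduces B) (hR' : R'.Reproduces B) (i : I) :
    R.theta R' B * (TensorProduct.map (R.F i) (R'.K i) + TensorProduct.map 1 (R'.F i)) =
      (TensorProduct.map 1 (R'.F i) + TensorProduct.map (R.F i) (R'.K' i)) * R.theta R' B := by
  have hadjR := sum_map_adjoint hR hR' (fun x => pairC Ω i • derR Ω i x)
    (fun y => y * FreeAlgebra.ι 𝕜 i) (fun x y => by simp [pair_mul_ι])
  have hadjL := sum_map_adjoint hR hR' (fun x => pairC Ω i • derL Ω i x)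
    (fun y => FreeAlgebra.ι 𝕜 i * y) (fun x y => by simp [pair_ι_mul])
  have e1 : R.theta R' B * TensorProduct.map (R.F i) (R'.K i) =
      (∑ k, TensorProduct.map (R.minus (B.b k)) (R'.plus (pairC Ω i • derR Ω i (B.bs k)))) *
        TensorProduct.map 1 (R'.K i) := by
    rw [hadjR, theta, Finset.sum_mul, Finset.sum_mul]
    refine Finset.sum_congr rfl fun k _ => ?_
    rw [← TensorProduct.map_mul, ← TensorProduct.map_mul, map_mul, minus_ι, mul_one]
  have e2 : TensorProduct.map (R.F i) (R'.K' i) * R.theta R' B =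
      TensorProduct.map 1 (R'.K' i) *
        ∑ k, TensorProduct.map (R.minus (B.b k)) (R'.plus (pairC Ω i • derL Ω i (B.bs k))) := by
    rw [hadjL, theta, Finset.mul_sum, Finset.mul_sum]
    refine Finset.sum_congr rfl fun k _ => ?_
    rw [← TensorProduct.map_mul, ← TensorProduct.map_mul, map_mul, minus_ι, one_mul]
  have hc : (vi Ω i - (vi Ω i)⁻¹)⁻¹ = -pairC Ω i := by
    rw [pairC, ← neg_sub, inv_neg]
  rw [mul_add, add_mul, e1, e2, add_comm, ← sub_eq_sub_iff_add_eq_add]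
  rw [theta, Finset.sum_mul, Finset.mul_sum, Finset.mul_sum, Finset.sum_mul,
    ← Finset.sum_sub_distrib, ← Finset.sum_sub_distrib]
  refine Finset.sum_congr rfl fun k _ => ?_
  -- Once multiplications by `θ_i` on the first leg are traded for skew derivations on the second,
  -- the identity holds term by term: it is the commutator formula for `b*`.
  have := R'.plus_mul_F_sub i (B.bs k)
  rw [hc] at this
  rw [← TensorProduct.map_mul, ← TensorProduct.map_mul, ← TensorProduct.map_mul,
    ← TensorProduct.map_mul, mul_one, one_mul]
  simp only [← TensorProduct.mapBilinear_apply]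
  rw [← map_sub, ← map_sub]
  congr 1
  rw [sub_eq_sub_iff_add_eq_add, ← sub_eq_iff_eq_add'.2 (eq_add_of_sub_eq this)]
  simp only [map_smul, mul_smul_comm, smul_mul_assoc, neg_smul, smul_sub]
  abel

/-- `Θ` times the diagonal factor intertwines `Δᵒᵖ` and `Δ`. -/
theorem intertwine (hR : R.Reproduces B) (hR' : R'.Reproduces B) (T : Module.End 𝕜 (M ⊗[𝕜] M'))
    (hT : ∀ lam mu, ∀ m ∈ R.V lam, ∀ m' ∈ R'.V mu,
      T (m ⊗ₜ m') = (brace Ω lam mu)⁻¹ • R.theta R' B (m ⊗ₜ m')) (y : FF I) :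
    T * R.coprodOp R' y = R.coprod R' y * T := by
  induction y using FreeAlgebra.induction with
  | grade0 r => simp [Algebra.commutes]
  | grade1 i =>
    refine R.tensor_ext R' fun lam mu m hm m' hm' => ?_
    -- On weight vectors the diagonal factor converts `F_i ⊗ 1` into `F_i ⊗ K_i` and `K'_i ⊗ F_i`
    -- into `1 ⊗ F_i`, the form in which `theta_comm_F` applies.
    have h1 := LinearMap.congr_fun (theta_comm_F hR hR' i) (m ⊗ₜ m')
    simp only [Module.End.mul_apply, LinearMap.add_apply, TensorProduct.map_tmul,
      Module.End.one_apply, map_add] at h1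
    simp only [coprodOp, coprod, FreeAlgebra.lift_ι_apply, Module.End.mul_apply,
      LinearMap.add_apply, TensorProduct.map_tmul, Module.End.one_apply, map_add,
      hT _ _ m hm m' hm', map_smul]
    rw [← h1, hT _ _ _ (R.F_mem i _ m hm) _ hm', R.K'_apply i _ m hm,
      ← TensorProduct.smul_tmul', map_smul, hT _ _ _ hm _ (R'.F_mem i _ m' hm'),
      R'.K_apply i _ m' hm', TensorProduct.tmul_smul, map_smul, smul_add, smul_smul, smul_smul,
      brace_sub_left, brace_sub_right]
    have h2 := brace_ne_zero Ω lam (e i)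
    congr 2
    · simp [mul_comm]
    · field_simp
  | add x y hx hy => rw [map_add, map_add, mul_add, add_mul, hx, hy]
  | mul x y hx hy => rw [map_mul, map_mul, ← mul_assoc, hx, mul_assoc, hy, mul_assoc]

theorem minus_word_mem (w : List I) (lam : I → ℤ) (m : M) (hm : m ∈ R.V lam) :
    R.minus (word w) m ∈ R.V (lam - wdeg w) :=
  R.minus_mem (word_mem_homog w) lam m hm

/-- `K'_i` acts on a vector already lowered by the left word. This lowering produces the coefficient
`{deg, i}` of `splits`; the rest depends only on `lam` and the right word. -/
theorem coprodOp_word (w : List I) (lam : I → ℤ) (m : M) (hm : m ∈ R.V lam) (m' : M') :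
    R.coprodOp R' (word w) (m ⊗ₜ m') = ((splits Ω w).map fun p =>
      (p.1 * (brace Ω lam (wdeg p.2.2))⁻¹) •
        (R.minus (word p.2.1) m ⊗ₜ[𝕜] R'.minus (word p.2.2) m')).sum := by
  induction w with
  | nil => simp [splits]
  | cons i w ih =>
    rw [word_cons, map_mul, Module.End.mul_apply, ih, map_list_sum, List.map_map, splits,
      List.map_append, List.sum_append, List.map_map, List.map_map, ← List.sum_map_add]
    congr 1
    refine List.map_congr_left fun p _ => ?_
    have h1 := R.K'_apply i _ _ (minus_word_mem p.2.1 lam m hm)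
    simp only [Function.comp, coprodOp, FreeAlgebra.lift_ι_apply, map_smul, LinearMap.add_apply,
      TensorProduct.map_tmul, Module.End.one_apply, h1, word_cons, map_mul, minus_ι,
      Module.End.mul_apply, wdeg_cons, brace_sub_left, brace_add_right, smul_add]
    congr 1
    rw [← TensorProduct.smul_tmul', smul_smul]
    congr 1
    simp only [mul_inv, inv_inv]
    ring

theorem coprod_word (w : List I) (lam : I → ℤ) (m : M) (m' : M') (hm' : m' ∈ R'.V lam) :
    R.coprod R' (word w) (m ⊗ₜ m') = ((splits Ω w).map fun p =>
      (p.1 * (brace Ω lam (wdeg p.2.2))⁻¹) •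
        (R.minus (word p.2.2) m ⊗ₜ[𝕜] R'.minus (word p.2.1) m')).sum := by
  induction w with
  | nil => simp [splits]
  | cons i w ih =>
    rw [word_cons, map_mul, Module.End.mul_apply, ih, map_list_sum, List.map_map, splits,
      List.map_append, List.sum_append, List.map_map, List.map_map, ← List.sum_map_add]
    congr 1
    refine List.map_congr_left fun p _ => ?_
    have h1 := R'.K'_apply i _ _ (minus_word_mem p.2.1 lam m' hm')
    simp only [Function.comp, coprod, FreeAlgebra.lift_ι_apply, map_smul, LinearMap.add_apply,
      TensorProduct.map_tmul, Module.End.one_apply, h1, word_cons, map_mul, minus_ι,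
      Module.End.mul_apply, wdeg_cons, brace_sub_left, brace_add_right, smul_add]
    congr 1
    rw [TensorProduct.tmul_smul, smul_smul]
    congr 1
    simp only [mul_inv, inv_inv]
    ring

omit [Fintype I] in
theorem natCast_eq_wdeg {mu : I → ℕ} {w : List I} (h : mu = fun i => w.count i) :
    (fun i => (mu i : ℤ)) = wdeg w := by
  subst h; rfl

/-- The pairing vanishes unless `w` has the degree of `k`. This makes the diagonal factor depend on
the family alone. -/
theorem pair_mul_brace_inv (lam : I → ℤ) (k : B.κ) (w : List I) :
    pair Ω (B.bs k) (word w) * (brace Ω lam (wdeg w))⁻¹ =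
      pair Ω (B.bs k) (word w) * (brace Ω lam (B.wt k))⁻¹ := by
  by_cases h : B.deg k = fun i => w.count i
  · rw [show B.wt k = wdeg w from natCast_eq_wdeg h]
  · rw [pair_homog_eq_zero Ω h (B.bs_mem k) (word_mem_homog w), zero_mul, zero_mul]

omit [Fintype I] [DecidableEq I] in
theorem sum_list_sum_smul {κ A N : Type*} [AddCommMonoid N] [Module 𝕜 N] (s : Finset κ)
    (L : List A) (f : κ → A → 𝕜) (X : κ → N) :
    ∑ k ∈ s, (L.map (f k)).sum • X k = (L.map fun a => ∑ k ∈ s, f k a • X k).sum := by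
  induction L with
  | nil => simp
  | cons a L ih => simp [add_smul, Finset.sum_add_distrib, ih]

/-- The expansion of a bilinear expression in the terms of the twisted coproduct. -/
theorem sum_splits {N : Type*} [AddCommGroup N] [Module 𝕜 N] (hR : R.Reproduces B)
    (hR' : R'.Reproduces B) (β : M →ₗ[𝕜] M' →ₗ[𝕜] N) (lam : I → ℤ) (m : M) (m' : M')
    (w : List I) :
    ((splits Ω w).map fun p => (p.1 * (brace Ω lam (wdeg p.2.2))⁻¹) •
        β (R.minus (word p.2.1) m) (R'.minus (word p.2.2) m')).sum =
      ∑ q : B.κ × B.κ, pair Ω (B.bs q.1 * B.bs q.2) (word w) •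
        (brace Ω lam (B.wt q.2))⁻¹ • β (R.minus (B.b q.1) m) (R'.minus (B.b q.2) m') := by
  simp only [pair_mul_word]
  rw [sum_list_sum_smul]
  congr 1
  refine List.map_congr_left fun p _ => ?_
  rw [hR.minus (word p.2.1), hR'.minus (word p.2.2), Fintype.sum_prod_type]
  simp only [LinearMap.sum_apply, map_sum, LinearMap.smul_apply, map_smul, Finset.smul_sum,
    smul_smul]
  rw [Finset.sum_comm]
  refine Finset.sum_congr rfl fun k _ => Finset.sum_congr rfl fun l _ => ?_
  congr 1
  have := pair_mul_brace_inv (Ω := Ω) lam l p.2.2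
  linear_combination (p.1 * pair Ω (B.bs k) (word p.2.1)) * this

/-- Expanding both words of each split in the family leaves products of pairings, which
`pair_mul_word` reassembles: the coproduct is dual to multiplication. -/
theorem coprodOp_apply (hR : R.Reproduces B) (hR' : R'.Reproduces B) (lam : I → ℤ) (m : M)
    (hm : m ∈ R.V lam) (m' : M') (y : FF I) :
    R.coprodOp R' y (m ⊗ₜ m') = ∑ q : B.κ × B.κ, pair Ω (B.bs q.1 * B.bs q.2) y •
      (brace Ω lam (B.wt q.2))⁻¹ • (R.minus (B.b q.1) m ⊗ₜ[𝕜] R'.minus (B.b q.2) m') := by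
  suffices h : LinearMap.applyₗ (m ⊗ₜ[𝕜] m') ∘ₗ (R.coprodOp R').toLinearMap =
      ∑ q : B.κ × B.κ, (pair Ω (B.bs q.1 * B.bs q.2)).smulRight
        ((brace Ω lam (B.wt q.2))⁻¹ • (R.minus (B.b q.1) m ⊗ₜ[𝕜] R'.minus (B.b q.2) m')) by
    simpa [LinearMap.sum_apply] using LinearMap.congr_fun h y
  refine linearMap_ext_word fun w => ?_
  have := sum_splits hR hR' (TensorProduct.mk 𝕜 M M') lam m m' w
  simpa [LinearMap.sum_apply, coprodOp_word w lam m hm m'] using this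

theorem coprod_apply (hR : R.Reproduces B) (hR' : R'.Reproduces B) (lam : I → ℤ) (m : M)
    (m' : M') (hm' : m' ∈ R'.V lam) (y : FF I) :
    R.coprod R' y (m ⊗ₜ m') = ∑ q : B.κ × B.κ, pair Ω (B.bs q.1 * B.bs q.2) y •
      (brace Ω lam (B.wt q.2))⁻¹ • (R.minus (B.b q.2) m ⊗ₜ[𝕜] R'.minus (B.b q.1) m') := by
  suffices h : LinearMap.applyₗ (m ⊗ₜ[𝕜] m') ∘ₗ (R.coprod R').toLinearMap =
      ∑ q : B.κ × B.κ, (pair Ω (B.bs q.1 * B.bs q.2)).smulRight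
        ((brace Ω lam (B.wt q.2))⁻¹ • (R.minus (B.b q.2) m ⊗ₜ[𝕜] R'.minus (B.b q.1) m')) by
    simpa [LinearMap.sum_apply] using LinearMap.congr_fun h y
  refine linearMap_ext_word fun w => ?_
  have := sum_splits hR' hR (TensorProduct.mk 𝕜 M M').flip lam m' m w
  simpa [LinearMap.sum_apply, coprod_word w lam m m' hm'] using this

variable {M'' : Type*} [AddCommGroup M''] [Module 𝕜 M''] {R'' : WeightRep Ω M''}

/-- `(Δᵒᵖ ⊗ 1)(Θ)` on `M ⊗ M' ⊗ M''`. -/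
theorem sum_coprodOp (hR : R.Reproduces B) (hR' : R'.Reproduces B) (hR'' : R''.Reproduces B)
    (lam : I → ℤ) (m : M) (hm : m ∈ R.V lam) (m' : M') (m'' : M'') :
    ∑ n, R.coprodOp R' (B.b n) (m ⊗ₜ m') ⊗ₜ[𝕜] R''.plus (B.bs n) m'' =
      ∑ q : B.κ × B.κ, (brace Ω lam (B.wt q.2))⁻¹ •
        ((R.minus (B.b q.1) m ⊗ₜ[𝕜] R'.minus (B.b q.2) m') ⊗ₜ[𝕜]
          R''.plus (B.bs q.1 * B.bs q.2) m'') := by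
  simp only [coprodOp_apply hR hR' lam m hm m', hR''.plus (_ * _), LinearMap.sum_apply,
    TensorProduct.sum_tmul, TensorProduct.tmul_sum, LinearMap.smul_apply, Finset.smul_sum]
  rw [Finset.sum_comm]
  refine Finset.sum_congr rfl fun q _ => Finset.sum_congr rfl fun n _ => ?_
  simp only [← TensorProduct.smul_tmul', TensorProduct.tmul_smul, smul_smul, mul_comm]

/-- `(Δ ⊗ 1)(Θ)` on `M ⊗ M' ⊗ M''`. -/
theorem sum_coprod (hR : R.Reproduces B) (hR' : R'.Reproduces B) (hR'' : R''.Reproduces B)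
    (lam : I → ℤ) (m : M) (m' : M') (hm' : m' ∈ R'.V lam) (m'' : M'') :
    ∑ n, R.coprod R' (B.b n) (m ⊗ₜ m') ⊗ₜ[𝕜] R''.plus (B.bs n) m'' =
      ∑ q : B.κ × B.κ, (brace Ω lam (B.wt q.2))⁻¹ •
        ((R.minus (B.b q.2) m ⊗ₜ[𝕜] R'.minus (B.b q.1) m') ⊗ₜ[𝕜]
          R''.plus (B.bs q.1 * B.bs q.2) m'') := by
  simp only [coprod_apply hR hR' lam m m' hm', hR''.plus (_ * _), LinearMap.sum_apply,
    TensorProduct.sum_tmul, TensorProduct.tmul_sum, LinearMap.smul_apply, Finset.smul_sum]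
  rw [Finset.sum_comm]
  refine Finset.sum_congr rfl fun q _ => Finset.sum_congr rfl fun n _ => ?_
  simp only [← TensorProduct.smul_tmul', TensorProduct.tmul_smul, smul_smul, mul_comm]

end WeightRep

end

section

variable {I : Type u} [Fintype I] [DecidableEq I]

namespace WeightRep

/-! ### The braid relation for weight representations -/

section Braid

variable {Ω : I → I → ℤ} {B : HomogFamily I}
  {M₁ : Type*} [AddCommGroup M₁] [Module 𝕜 M₁] {R₁ : WeightRep Ω M₁}
  {M₂ : Type*} [AddCommGroup M₂] [Module 𝕜 M₂] {R₂ : WeightRep Ω M₂}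
  {M₃ : Type*} [AddCommGroup M₃] [Module 𝕜 M₃] {R₃ : WeightRep Ω M₃}

/-- `r = Θ ∘ f̃ ∘ P`, on weight vectors. -/
def IsRMatrix (R₁ : WeightRep Ω M₁) (R₂ : WeightRep Ω M₂) (B : HomogFamily I)
    (r : M₁ ⊗[𝕜] M₂ →ₗ[𝕜] M₂ ⊗[𝕜] M₁) : Prop :=
  ∀ lam mu, ∀ m ∈ R₁.V lam, ∀ m' ∈ R₂.V mu,
    r (m ⊗ₜ m') = (brace Ω mu lam)⁻¹ • ∑ k, R₂.minus (B.b k) m' ⊗ₜ[𝕜] R₁.plus (B.bs k) m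

variable (h₁ : R₁.Reproduces B) (h₂ : R₂.Reproduces B) (h₃ : R₃.Reproduces B)
  {r₁₂ : M₁ ⊗[𝕜] M₂ →ₗ[𝕜] M₂ ⊗[𝕜] M₁} (hr₁₂ : IsRMatrix R₁ R₂ B r₁₂)
  {r₁₃ : M₁ ⊗[𝕜] M₃ →ₗ[𝕜] M₃ ⊗[𝕜] M₁} (hr₁₃ : IsRMatrix R₁ R₃ B r₁₃)
  {r₂₃ : M₂ ⊗[𝕜] M₃ →ₗ[𝕜] M₃ ⊗[𝕜] M₂} (hr₂₃ : IsRMatrix R₂ R₃ B r₂₃)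

/-- The operator `Id ⊗ r` on a left-bracketed triple tensor product. -/
def onLast (M : Type*) [AddCommGroup M] [Module 𝕜 M] (r : M₁ ⊗[𝕜] M₂ →ₗ[𝕜] M₂ ⊗[𝕜] M₁) :
    (M ⊗[𝕜] M₁) ⊗[𝕜] M₂ →ₗ[𝕜] (M ⊗[𝕜] M₂) ⊗[𝕜] M₁ :=
  (TensorProduct.assoc 𝕜 M M₂ M₁).symm.toLinearMap ∘ₗ r.lTensor M ∘ₗ
    (TensorProduct.assoc 𝕜 M M₁ M₂).toLinearMap

include hr₁₂ in
theorem onLast_apply {M : Type*} [AddCommGroup M] [Module 𝕜 M] (lam mu : I → ℤ) (u : M) (m : M₁)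
    (hm : m ∈ R₁.V lam) (m' : M₂) (hm' : m' ∈ R₂.V mu) :
    onLast M r₁₂ ((u ⊗ₜ m) ⊗ₜ m') = (brace Ω mu lam)⁻¹ •
      ∑ k, (u ⊗ₜ[𝕜] R₂.minus (B.b k) m') ⊗ₜ[𝕜] R₁.plus (B.bs k) m := by
  simp [onLast, hr₁₂ lam mu m hm m' hm', TensorProduct.tmul_sum, -map_smul, -map_sum]
  simp [map_sum]

include hr₁₂ in
theorem rTensor_apply {M : Type*} [AddCommGroup M] [Module 𝕜 M] (lam mu : I → ℤ) (u : M) (m : M₁)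
    (hm : m ∈ R₁.V lam) (m' : M₂) (hm' : m' ∈ R₂.V mu) :
    r₁₂.rTensor M ((m ⊗ₜ m') ⊗ₜ u) = (brace Ω mu lam)⁻¹ •
      ∑ k, (R₂.minus (B.b k) m' ⊗ₜ[𝕜] R₁.plus (B.bs k) m) ⊗ₜ[𝕜] u := by
  rw [LinearMap.rTensor_tmul, hr₁₂ lam mu m hm m' hm', ← TensorProduct.smul_tmul',
    TensorProduct.sum_tmul]

theorem plus_fam_mem (lam : I → ℤ) (m : M₁) (hm : m ∈ R₁.V lam) (k : B.κ) :
    R₁.plus (B.bs k) m ∈ R₁.V (lam + B.wt k) := R₁.plus_mem (B.bs_mem k) lam m hm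

theorem minus_fam_mem (lam : I → ℤ) (m : M₁) (hm : m ∈ R₁.V lam) (k : B.κ) :
    R₁.minus (B.b k) m ∈ R₁.V (lam - B.wt k) := R₁.minus_mem (B.b_mem k) lam m hm

include h₁ h₂ h₃ hr₁₂ hr₁₃ hr₂₃ in
/-- The braid relation on weight vectors. -/
theorem braid_apply (l₁ l₂ l₃ : I → ℤ) (m₁ : M₁) (hm₁ : m₁ ∈ R₁.V l₁) (m₂ : M₂)
    (hm₂ : m₂ ∈ R₂.V l₂) (m₃ : M₃) (hm₃ : m₃ ∈ R₃.V l₃) :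
    r₂₃.rTensor M₁ (onLast M₂ r₁₃ (r₁₂.rTensor M₃ ((m₁ ⊗ₜ m₂) ⊗ₜ m₃))) =
      onLast M₃ r₁₂ (r₁₃.rTensor M₂ (onLast M₁ r₂₃ ((m₁ ⊗ₜ m₂) ⊗ₜ m₃))) := by
  -- `T` is `r₂₃` with the flip undone, that is, `Θ ∘ f̃` on `M₃ ⊗ M₂`.
  let T : Module.End 𝕜 (M₃ ⊗[𝕜] M₂) := r₂₃ ∘ₗ (TensorProduct.comm 𝕜 M₃ M₂).toLinearMap
  have hTr (x : M₂) (y : M₃) : r₂₃ (x ⊗ₜ y) = T (y ⊗ₜ x) := by simp [T]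
  have hT : ∀ lam mu, ∀ m ∈ R₃.V lam, ∀ m' ∈ R₂.V mu,
      T (m ⊗ₜ m') = (brace Ω lam mu)⁻¹ • R₃.theta R₂ B (m ⊗ₜ m') := by
    intro lam mu m hm m' hm'
    rw [← hTr, hr₂₃ mu lam m' hm' m hm]
    simp [theta, LinearMap.sum_apply]
  have hint (n : B.κ) : T (R₃.coprodOp R₂ (B.b n) (m₃ ⊗ₜ m₂)) =
      R₃.coprod R₂ (B.b n) (T (m₃ ⊗ₜ m₂)) :=
    LinearMap.congr_fun (intertwine h₃ h₂ T hT (B.b n)) (m₃ ⊗ₜ m₂)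
  have hl : r₂₃.rTensor M₁ (onLast M₂ r₁₃ (r₁₂.rTensor M₃ ((m₁ ⊗ₜ m₂) ⊗ₜ m₃))) =
      ((brace Ω l₂ l₁)⁻¹ * (brace Ω l₃ l₁)⁻¹) • T.rTensor M₁
        (∑ n, R₃.coprodOp R₂ (B.b n) (m₃ ⊗ₜ m₂) ⊗ₜ[𝕜] R₁.plus (B.bs n) m₁) := by
    -- The first braiding raises the weight of the `M₁`-factor by `B.wt k`; the factor `{l₃, B.wt
    -- k}⁻¹` that the second one then contributes is the coefficient in `sum_coprodOp`.
    rw [sum_coprodOp h₃ h₂ h₁ l₃ m₃ hm₃ m₂ m₁, rTensor_apply hr₁₂ l₁ l₂ m₃ m₁ hm₁ m₂ hm₂,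
      Fintype.sum_prod_type, Finset.sum_comm]
    simp only [map_smul, map_sum, onLast_apply hr₁₃ _ _ _ _ (plus_fam_mem l₁ m₁ hm₁ _) _ hm₃,
      LinearMap.rTensor_tmul, hTr, Finset.smul_sum, smul_smul, brace_add_right, map_mul,
      Module.End.mul_apply, mul_inv, mul_assoc]
  have hrr : onLast M₃ r₁₂ (r₁₃.rTensor M₂ (onLast M₁ r₂₃ ((m₁ ⊗ₜ m₂) ⊗ₜ m₃))) =
      ((brace Ω l₂ l₁)⁻¹ * (brace Ω l₃ l₁)⁻¹ * (brace Ω l₃ l₂)⁻¹) • ∑ k, ∑ n,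
        R₃.coprod R₂ (B.b n) (R₃.minus (B.b k) m₃ ⊗ₜ R₂.plus (B.bs k) m₂) ⊗ₜ[𝕜]
          R₁.plus (B.bs n) m₁ := by
    rw [onLast_apply hr₂₃ l₂ l₃ m₁ m₂ hm₂ m₃ hm₃]
    simp only [map_smul, map_sum, Finset.smul_sum]
    refine Finset.sum_congr rfl fun k _ => ?_
    rw [← Finset.smul_sum, sum_coprod h₃ h₂ h₁ _ _ _ (plus_fam_mem l₂ m₂ hm₂ k),
      rTensor_apply hr₁₃ l₁ _ _ m₁ hm₁ _ (minus_fam_mem l₃ m₃ hm₃ k), Fintype.sum_prod_type,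
      Finset.sum_comm]
    simp only [map_smul, map_sum, onLast_apply hr₁₂ _ _ _ _ (plus_fam_mem l₁ m₁ hm₁ _) _
      (plus_fam_mem l₂ m₂ hm₂ k), Finset.smul_sum, smul_smul, map_mul, Module.End.mul_apply]
    refine Finset.sum_congr rfl fun n _ => Finset.sum_congr rfl fun j _ => ?_
    congr 1
    -- `M₃` was lowered and `M₂` raised by `B.wt k`, so the factors `{B.wt k, l₁}` cancel.
    have := brace_ne_zero Ω (B.wt k) l₁
    simp only [brace_add_left, brace_add_right, brace_sub_left, mul_inv, inv_inv]
    field_simp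
  -- What remains besides the common scalar is the intertwining property on `m₃ ⊗ m₂`; the extra
  -- `{l₃, l₂}⁻¹` is the diagonal factor of `T`.
  rw [hl, hrr, mul_smul _ (brace Ω l₃ l₂)⁻¹]
  congr 1
  rw [map_sum, Finset.sum_comm, Finset.smul_sum]
  refine Finset.sum_congr rfl fun n _ => ?_
  rw [LinearMap.rTensor_tmul, hint, hT l₃ l₂ m₃ hm₃ m₂ hm₂, map_smul, ← TensorProduct.smul_tmul',
    theta, LinearMap.sum_apply, map_sum, TensorProduct.sum_tmul]
  rfl

include h₁ h₂ h₃ hr₁₂ hr₁₃ hr₂₃ in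
theorem braid : r₂₃.rTensor M₁ ∘ₗ onLast M₂ r₁₃ ∘ₗ r₁₂.rTensor M₃ =
    onLast M₃ r₁₂ ∘ₗ r₁₃.rTensor M₂ ∘ₗ onLast M₁ r₂₃ := by
  refine TensorProduct.ext (R₁.tensor_ext R₂ fun l₁ l₂ m₁ hm₁ m₂ hm₂ =>
    R₃.linearMap_ext fun l₃ m₃ hm₃ => ?_)
  exact braid_apply h₁ h₂ h₃ hr₁₂ hr₁₃ hr₂₃ l₁ l₂ l₃ m₁ hm₁ m₂ hm₂ m₃ hm₃

end Braid

end WeightRep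

/-! ### Weight modules over `U_{v,t}` -/

section Modules

variable {Ω : I → I → ℤ}
variable {M : Type*} [AddCommGroup M] [Module 𝕜 M] [Module (U Ω) M] [IsScalarTower 𝕜 (U Ω) M]

theorem gen_K_mul_gen_F (i j : I) : gen Ω (Gen.K i) * gen Ω (Gen.F j) =
    (v ^ (-(Ω i j + Ω j i)) * t ^ (Ω i j - Ω j i)) • (gen Ω (Gen.F j) * gen Ω (Gen.K i)) := by
  have h : gen Ω (Gen.K i) * gen Ω (Gen.F j) * gen Ω (Gen.Ki i) =
      (v ^ (-(Ω i j + Ω j i)) * t ^ (Ω i j - Ω j i)) • gen Ω (Gen.F j) := by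
    simpa only [gen, map_mul, map_smul] using mkU_rel Ω (Rel.K_F i j)
  have h' : gen Ω (Gen.Ki i) * gen Ω (Gen.K i) = 1 := by
    simpa only [gen, map_mul, map_one] using mkU_rel Ω (Rel.Ki_K i)
  rw [← smul_mul_assoc, ← h, mul_assoc _ (gen Ω (Gen.Ki i)), h', mul_one]

theorem gen_K'_mul_gen_F (i j : I) : gen Ω (Gen.K' i) * gen Ω (Gen.F j) =
    (v ^ (Ω i j + Ω j i) * t ^ (Ω i j - Ω j i)) • (gen Ω (Gen.F j) * gen Ω (Gen.K' i)) := by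
  have h : gen Ω (Gen.K' i) * gen Ω (Gen.F j) * gen Ω (Gen.Ki' i) =
      (v ^ (Ω i j + Ω j i) * t ^ (Ω i j - Ω j i)) • gen Ω (Gen.F j) := by
    simpa only [gen, map_mul, map_smul] using mkU_rel Ω (Rel.K'_F i j)
  have h' : gen Ω (Gen.Ki' i) * gen Ω (Gen.K' i) = 1 := by
    simpa only [gen, map_mul, map_one] using mkU_rel Ω (Rel.Ki'_K' i)
  rw [← smul_mul_assoc, ← h, mul_assoc _ (gen Ω (Gen.Ki' i)), h', mul_one]

theorem ang_sub_left (a b c : I → ℤ) : ang Ω (a - b) c = ang Ω a c - ang Ω b c := by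
  rw [eq_sub_iff_add_eq, ← ang_add_left, sub_add_cancel]

theorem ang_sub_right (a b c : I → ℤ) : ang Ω a (b - c) = ang Ω a b - ang Ω a c := by
  rw [eq_sub_iff_add_eq, ← ang_add_right, sub_add_cancel]

/-- `F_j` maps `M_lam` to `M_{lam - j}`. -/
theorem gen_F_smul_mem (j : I) (lam : I → ℤ) (m : M) (hm : m ∈ weightSpace Ω M lam) :
    gen Ω (Gen.F j) • m ∈ weightSpace Ω M (lam - e j) := by
  intro i
  obtain ⟨h1, h2⟩ := hm i
  have hv := v_ne_zero
  have ht := t_ne_zero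
  have hF (c : 𝕜) : gen Ω (Gen.F j) • c • m = c • gen Ω (Gen.F j) • m := smul_comm _ _ _
  constructor
  · rw [smul_smul, gen_K_mul_gen_F, smul_assoc (_ * _ : 𝕜) (_ * _ : U Ω) m,
      mul_smul (gen Ω (Gen.F j)), h1, hF, smul_smul, mul_mul_mul_comm, cc, cc,
      ← zpow_add₀ hv, ← zpow_add₀ ht]
    simp only [dot, ang_sub_left, ang_sub_right, ang_e_e]
    congr 3 <;> ring
  · rw [smul_smul, gen_K'_mul_gen_F, smul_assoc (_ * _ : 𝕜) (_ * _ : U Ω) m,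
      mul_smul (gen Ω (Gen.F j)), h2, hF, smul_smul, mul_mul_mul_comm, cc, cc,
      ← zpow_add₀ hv, ← zpow_add₀ ht]
    simp only [dot, ang_sub_left, ang_sub_right, ang_e_e]
    congr 3 <;> ring

variable (Ω M)

/-- The weight representation underlying a weight module. -/
def WeightRep.ofModule [IsWeightModule Ω M] : WeightRep Ω M where
  E i := act Ω M (gen Ω (Gen.E i))
  F i := act Ω M (gen Ω (Gen.F i))
  K i := act Ω M (gen Ω (Gen.K i))
  K' i := act Ω M (gen Ω (Gen.K' i))
  V := weightSpace Ω M
  indep := (IsWeightModule.isInternal (Ω := Ω) (M := M)).submodule_iSupIndep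
  iSup_eq_top := (IsWeightModule.isInternal (Ω := Ω) (M := M)).submodule_iSup_eq_top
  E_mem i lam m hm := gen_E_smul_mem i lam m hm
  F_mem i lam m hm := gen_F_smul_mem i lam m hm
  K_apply i lam m hm := (hm i).1
  K'_apply i lam m hm := by
    refine (hm i).2.trans ?_
    rw [brace, mul_inv, ← zpow_neg, ← zpow_neg, cc, neg_sub, dot, dot, add_comm]
  comm_same i := by
    rw [← map_mul, ← map_mul, ← map_sub, ← map_sub, ← map_smul]
    congr 1
    simpa only [gen, map_mul, map_smul, map_sub] using mkU_rel Ω (Rel.E_F_same i)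
  comm_ne i j h := by
    rw [← map_mul, ← map_mul, ← map_sub]
    have : gen Ω (Gen.E i) * gen Ω (Gen.F j) - gen Ω (Gen.F j) * gen Ω (Gen.E i) = 0 := by
      simpa only [gen, map_mul, map_zero, map_sub] using mkU_rel Ω (Rel.E_F_ne i j h)
    rw [this, map_zero]

variable {M}

theorem ofModule_plus [IsWeightModule Ω M] (x : FF I) :
    (WeightRep.ofModule Ω M).plus x = act Ω M (plus Ω x) := by
  have : (WeightRep.ofModule Ω M).plus = (act Ω M).comp (plus Ω) := by
    ext i : 2
    simp [WeightRep.plus, plus, WeightRep.ofModule]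
  exact DFunLike.congr_fun this x

theorem ofModule_minus [IsWeightModule Ω M] (x : FF I) :
    (WeightRep.ofModule Ω M).minus x = act Ω M (minus Ω x) := by
  have : (WeightRep.ofModule Ω M).minus = (act Ω M).comp (minus Ω) := by
    ext i : 2
    simp [WeightRep.minus, minus, WeightRep.ofModule]
  exact DFunLike.congr_fun this x

end Modules

/-! ### Only finitely many degrees act -/

namespace WeightRep

variable {Ω : I → I → ℤ} {M : Type*} [AddCommGroup M] [Module 𝕜 M] (R : WeightRep Ω M)

/-- The degrees in which `'f` acts nontrivially. -/
def degrees : Set (I → ℕ) := {mu | ∃ x ∈ homog mu, R.plus x ≠ 0 ∨ R.minus x ≠ 0}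

/-- An element of degree `mu` shifts weights by `mu`, so `mu` is a difference of two of the finitely
many weights. -/
theorem finite_plus_degrees [FiniteDimensional 𝕜 M] :
    {mu : I → ℕ | ∃ x ∈ homog mu, R.plus x ≠ 0}.Finite := by
  have hinj : Function.Injective (fun (mu : I → ℕ) (i : I) => (mu i : ℤ)) := by
    intro a b h
    ext i
    exact Int.ofNat.inj (congrFun h i)
  refine ((R.finite_weights.image2 (fun a b => a - b) R.finite_weights).preimage
    hinj.injOn).subset ?_
  rintro mu ⟨x, hx, hne⟩
  by_contra hcon
  refine hne (R.linearMap_ext fun lam m hm => ?_)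
  by_contra h
  refine hcon ⟨_, ?_, lam, ?_, add_sub_cancel_left lam _⟩
  · exact (Submodule.ne_bot_iff _).2 ⟨_, R.plus_mem hx lam m hm, h⟩
  · exact (Submodule.ne_bot_iff _).2 ⟨m, hm, fun h0 => h (by rw [h0, map_zero, map_zero])⟩

theorem finite_degrees [FiniteDimensional 𝕜 M] : R.degrees.Finite := by
  refine (R.finite_plus_degrees.union R.swap.finite_plus_degrees).subset ?_
  rintro mu ⟨x, hx, h | h⟩
  · exact Or.inl ⟨x, hx, h⟩
  · exact Or.inr ⟨x, hx, h⟩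

end WeightRep

/-! ### Dual bases reproduce the action -/

namespace DualBases

variable {Ω : I → I → ℤ} (D : DualBases Ω)

/-- The dual bases in a finite set of degrees. -/
def family (S : Finset (I → ℕ)) : HomogFamily I where
  κ := Σ mu : S, Fin (D.n mu)
  deg k := k.1
  b k := D.b k.1 k.2
  bs k := D.bstar k.1 k.2
  b_mem _ := D.b_mem _ _
  bs_mem _ := D.bstar_mem _ _

/-- Modulo the radical, the coefficients of `y` in the basis `b` are read off by pairing with `b*`.
-/
theorem pair_expand_right {mu : I → ℕ} {x y : FF I} (hx : x ∈ homog mu) (hy : y ∈ homog mu) :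
    pair Ω x y = ∑ k, pair Ω (D.bstar mu k) y * pair Ω x (D.b mu k) := by
  obtain ⟨c, hc⟩ := D.span mu y hy
  have h1 (z : FF I) (hz : z ∈ homog mu) : pair Ω z y = ∑ k, c k * pair Ω z (D.b mu k) := by
    have := hc z hz
    rwa [map_sub, sub_eq_zero, map_sum, Finset.sum_congr rfl fun k _ => by
      rw [map_smul, smul_eq_mul]] at this
  have h2 (k : Fin (D.n mu)) : pair Ω (D.bstar mu k) y = c k := by
    rw [h1 _ (D.bstar_mem mu k)]
    simp [D.dual]
  rw [h1 x hx]
  simp [h2]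

variable {M : Type*} [AddCommGroup M] [Module 𝕜 M] [FiniteDimensional 𝕜 M] (R : WeightRep Ω M)

/-- In a degree of `S`, an element differs from its expansion by an element of the radical, which
acts by zero. All other degrees act by zero on the module. -/
theorem reproduces (hΩ : IsCartan Ω) (S : Finset (I → ℕ)) (hS : R.degrees ⊆ S) :
    R.Reproduces (D.family S) where
  plus x := by
    suffices h : R.plus.toLinearMap = ∑ k, ((pair Ω).flip ((D.family S).b k)).smulRight
        (R.plus ((D.family S).bs k)) by
      simpa [LinearMap.sum_apply] using LinearMap.congr_fun h x
    refine linearMap_ext_word fun w => ?_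
    have hw := word_mem_homog w
    generalize word w = x at hw
    generalize (fun i => w.count i) = mu at hw
    simp only [AlgHom.toLinearMap_apply, LinearMap.sum_apply, LinearMap.smulRight_apply,
      LinearMap.flip_apply]
    by_cases hmu : mu ∈ S
    · have h1 : R.plus (x - ∑ k, pair Ω x (D.b mu k) • D.bstar mu k) = 0 := by
        have hz : x - ∑ k, pair Ω x (D.b mu k) • D.bstar mu k ∈ homog mu :=
          Submodule.sub_mem _ hw (Submodule.sum_mem _ fun k _ =>
            Submodule.smul_mem _ _ (D.bstar_mem mu k))
        refine R.plus_eq_zero_of_pair_eq_zero hΩ hz fun y => ?_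
        suffices h : pair Ω (x - ∑ k, pair Ω x (D.b mu k) • D.bstar mu k) = 0 by
          rw [h, LinearMap.zero_apply]
        -- Words of a degree other than `mu` are orthogonal for degree reasons; on those of degree
        -- `mu`, `pair_expand_right` applies.
        refine linearMap_ext_word fun w' => ?_
        by_cases hw' : mu = fun i => w'.count i
        · have hy := word_mem_homog w'
          rw [← hw'] at hy
          rw [map_sub, LinearMap.sub_apply, D.pair_expand_right hw hy, map_sum]
          simp [LinearMap.sum_apply, mul_comm]
        · exact pair_homog_eq_zero Ω hw' hz (word_mem_homog w')
      rw [map_sub, sub_eq_zero] at h1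
      rw [h1, map_sum]
      refine Eq.trans ?_ (Fintype.sum_sigma _).symm
      rw [Finset.sum_eq_single (⟨mu, hmu⟩ : S)]
      · exact Finset.sum_congr rfl fun k _ => map_smul _ _ _
      · intro nu _ hne
        refine Finset.sum_eq_zero fun k _ => ?_
        have : pair Ω x (D.b nu k) = 0 := pair_homog_eq_zero Ω
          (fun h => hne (Subtype.ext h.symm)) hw (D.b_mem nu k)
        exact (congrArg (· • _) this).trans (zero_smul _ _)
      · simp
    · have h1 : R.plus x = 0 := by
        by_contra h
        exact hmu (hS ⟨x, hw, Or.inl h⟩)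
      rw [h1]
      refine (Finset.sum_eq_zero fun k _ => ?_).symm
      rw [pair_homog_eq_zero Ω (fun h : mu = (D.family S).deg k => hmu (by rw [h]; exact k.1.2)) hw
        ((D.family S).b_mem k), zero_smul]
  minus y := by
    suffices h : R.minus.toLinearMap = ∑ k, (pair Ω ((D.family S).bs k)).smulRight
        (R.minus ((D.family S).b k)) by
      simpa [LinearMap.sum_apply] using LinearMap.congr_fun h y
    refine linearMap_ext_word fun w => ?_
    have hw := word_mem_homog w
    generalize word w = y at hw
    generalize (fun i => w.count i) = mu at hw
    simp only [AlgHom.toLinearMap_apply, LinearMap.sum_apply, LinearMap.smulRight_apply]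
    by_cases hmu : mu ∈ S
    · have h1 : R.minus (y - ∑ k, pair Ω (D.bstar mu k) y • D.b mu k) = 0 := by
        have hz : y - ∑ k, pair Ω (D.bstar mu k) y • D.b mu k ∈ homog mu :=
          Submodule.sub_mem _ hw (Submodule.sum_mem _ fun k _ =>
            Submodule.smul_mem _ _ (D.b_mem mu k))
        refine R.minus_eq_zero_of_pair_eq_zero hΩ hz fun x => ?_
        suffices h : (pair Ω).flip (y - ∑ k, pair Ω (D.bstar mu k) y • D.b mu k) = 0 by
          rw [← LinearMap.flip_apply, h, LinearMap.zero_apply]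
        refine linearMap_ext_word fun w' => ?_
        rw [LinearMap.flip_apply, LinearMap.zero_apply]
        by_cases hw' : (fun i => w'.count i) = mu
        · have hx := word_mem_homog w'
          rw [hw'] at hx
          rw [map_sub, D.pair_expand_right hx hw, map_sum]
          simp
        · exact pair_homog_eq_zero Ω hw' (word_mem_homog w') hz
      rw [map_sub, sub_eq_zero] at h1
      rw [h1, map_sum]
      refine Eq.trans ?_ (Fintype.sum_sigma _).symm
      rw [Finset.sum_eq_single (⟨mu, hmu⟩ : S)]
      · exact Finset.sum_congr rfl fun k _ => map_smul _ _ _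
      · intro nu _ hne
        refine Finset.sum_eq_zero fun k _ => ?_
        have : pair Ω (D.bstar nu k) y = 0 := pair_homog_eq_zero Ω
          (fun h => hne (Subtype.ext h)) (D.bstar_mem nu k) hw
        exact (congrArg (· • _) this).trans (zero_smul _ _)
      · simp
    · have h1 : R.minus y = 0 := by
        by_contra h
        exact hmu (hS ⟨y, hw, Or.inr h⟩)
      rw [h1]
      refine (Finset.sum_eq_zero fun k _ => ?_).symm
      rw [pair_homog_eq_zero Ω (fun h : (D.family S).deg k = mu => hmu (by rw [← h]; exact k.1.2))
        ((D.family S).bs_mem k) hw, zero_smul]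

end DualBases

/-! ### Comparison with the R-matrix of weight modules -/

section RMatrix

variable {Ω : I → I → ℤ} (D : DualBases Ω)
variable (M : Type*) [AddCommGroup M] [Module 𝕜 M] [Module (U Ω) M] [IsScalarTower 𝕜 (U Ω) M]
  [IsWeightModule Ω M]
variable (M' : Type*) [AddCommGroup M'] [Module 𝕜 M'] [Module (U Ω) M']
  [IsScalarTower 𝕜 (U Ω) M'] [IsWeightModule Ω M']

/-- `Θ_mu` acts on the second factor through `b*`, so it suffices that `S` contains the degrees of
`M'`. -/
theorem thetaOn_eq (S : Finset (I → ℕ)) (hS : (WeightRep.ofModule Ω M').degrees ⊆ S) :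
    thetaOn M M' D =
      (WeightRep.ofModule Ω M).theta (WeightRep.ofModule Ω M') (D.family S) := by
  rw [thetaOn, finsum_eq_sum_of_support_subset (s := S)]
  · rw [WeightRep.theta]
    refine Eq.trans ?_ (Fintype.sum_sigma _).symm
    rw [← Finset.sum_coe_sort S]
    refine Finset.sum_congr rfl fun mu _ => ?_
    rw [DualBases.theta, map_sum]
    refine Finset.sum_congr rfl fun k _ => ?_
    rw [ofModule_minus, ofModule_plus]
    simp [actTensor]
    rfl
  · intro mu hmu
    apply hS
    by_contra hcon
    apply hmu
    have hz (k : Fin (D.n mu)) : act Ω M' (plus Ω (D.bstar mu k)) = 0 := by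
      by_contra h
      exact hcon ⟨_, D.bstar_mem mu k, Or.inl (by rwa [ofModule_plus])⟩
    simp [actTensor, DualBases.theta, hz]

theorem isRMatrix_rmat (S : Finset (I → ℕ)) (hS : (WeightRep.ofModule Ω M).degrees ⊆ S) :
    WeightRep.IsRMatrix (WeightRep.ofModule Ω M) (WeightRep.ofModule Ω M') (D.family S)
      (rmat M M' D) := by
  intro lam mu m hm m' hm'
  rw [rmat, thetaOn_eq D M' M S hS, LinearMap.comp_apply, LinearMap.comp_apply,
    LinearEquiv.coe_coe, TensorProduct.comm_tmul, ftilde_tmul mu lam m' hm' m hm, map_smul, f,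
    WeightRep.theta, LinearMap.sum_apply]
  rfl

end RMatrix

end

end TwoParam

end

open TwoParam in
theorem mainTheorem2 {I : Type*} [Fintype I] [DecidableEq I]
    (Ω : I → I → ℤ) (hΩ : IsCartan Ω) (D : DualBases Ω)
    (M₁ M₂ M₃ : Type*)
    [AddCommGroup M₁] [Module 𝕜 M₁] [Module (U Ω) M₁] [IsScalarTower 𝕜 (U Ω) M₁]
    [FiniteDimensional 𝕜 M₁] [IsWeightModule Ω M₁]
    [AddCommGroup M₂] [Module 𝕜 M₂] [Module (U Ω) M₂] [IsScalarTower 𝕜 (U Ω) M₂]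
    [FiniteDimensional 𝕜 M₂] [IsWeightModule Ω M₂]
    [AddCommGroup M₃] [Module 𝕜 M₃] [Module (U Ω) M₃] [IsScalarTower 𝕜 (U Ω) M₃]
    [FiniteDimensional 𝕜 M₃] [IsWeightModule Ω M₃] :
    rmat12 M₂ M₃ M₁ D ∘ₗ rmat23 M₂ M₁ M₃ D ∘ₗ rmat12 M₁ M₂ M₃ D =
      rmat23 M₃ M₁ M₂ D ∘ₗ rmat12 M₁ M₃ M₂ D ∘ₗ rmat23 M₁ M₂ M₃ D := by
  let R₁ := WeightRep.ofModule Ω M₁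
  let R₂ := WeightRep.ofModule Ω M₂
  let R₃ := WeightRep.ofModule Ω M₃
  -- One finite family must serve all three modules, since the argument uses the same `b`, `b*` on
  -- each factor.
  let S := R₁.finite_degrees.toFinset ∪ R₂.finite_degrees.toFinset ∪
    R₃.finite_degrees.toFinset
  have h₁ : R₁.degrees ⊆ S := fun mu h => by simp [S, h]
  have h₂ : R₂.degrees ⊆ S := fun mu h => by simp [S, h]
  have h₃ : R₃.degrees ⊆ S := fun mu h => by simp [S, h]
  exact WeightRep.braid (D.reproduces R₁ hΩ S h₁) (D.reproduces R₂ hΩ S h₂)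
    (D.reproduces R₃ hΩ S h₃) (isRMatrix_rmat D M₁ M₂ S h₁) (isRMatrix_rmat D M₁ M₃ S h₁)
    (isRMatrix_rmat D M₂ M₃ S h₂)
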